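/- Let $\mathbb F_q$ be a finite field with $\operatorname{char}\mathbb F_q>3$ and $K=\mathbb F_q(t)$. For an elliptic curve $E/K$ let $\Delta$ be its minimal discriminant, a divisor on $\mathbb P^1_{\mathbb F_q}$, and let $ht(\Delta)=q^{\deg\Delta}$. More generally, for a cubic Weierstrass curve $E/K$ that is smooth or nodal, let $n(E)$ be the degree of the fundamental line bundle of its minimal Weierstrass model over $\mathbb P^1$. For a family of such curves, the unweighted count is the number of its $K$-isomorphism classes, and the weighted count is $\sum_E 1/|\mathrm{Aut}_K(E)|$ over these classes. Let $\mathcal N(B)$ and $\mathcal N^w(B)$ be the unweighted and the weighted count of elliptic curves over $K$ with $ht(\Delta)\le B$ (equivalently, of minimal elliptic curves over $\mathbb P^1_{\mathbb F_q}$). Put $\delta(x)=1$ if $x\mid q-1$ and $\delta(x)=0$ otherwise. For every elliptic curve, $\deg\Delta=12\,n(E)$ with $n(E)\ge 0$. Let $B=q^{12m}$ with $m\ge 1$ an integer. There are finitely many isomorphism classes of smooth or nodal curves with $q^{12n(E)}\le B$, and $$\mathcal N^w(B)=\frac{q^9-1}{q^8-q^7}B^{5/6}-B^{1/6},$$ $$\mathcal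 N(B)=2\,\frac{q^9-1}{q^8-q^7}B^{5/6}+4\delta(6)\frac{q^5-1}{q^5-q^4}B^{1/2}+2\delta(4)\frac{q^3-1}{q^3-q^2}B^{1/3}-2B^{1/6}+4\delta(6)+2\delta(4).$$ For a real number $B\ge q^{12}$ that is not of the form $q^{12m}$, the same holds with $B$ replaced, on the right-hand sides, by the largest $q^{12m}\le B$. The lower-order terms arise as follows, where all the counts are restricted to $q^{12n(E)}\le B$ and the same replacement of $B$ applies. (i) $\mathcal N^w(B)$ (respectively $\mathcal N(B)$) is the weighted (respectively unweighted) count of all smooth or nodal Weierstrass curves minus that of the nodal ones (the $\mu_2$-twist family at $j=\infty$). The weighted count of all of them is $\frac{q^9-1}{q^8-q^7}B^{5/6}+1$. The nodal ones have weighted count $B^{1/6}+1$ and unweighted count $2B^{1/6}+2$. (ii) $\mathcal N(B)=2\mathcal N^w(B)+4\delta(6)\,\mathcal N^w_{j=0}(B)+2\delta(4)\,\mathcal N^w_{j=1728}(B)$, where $\mathcal N^w_{j=0}$ and $\mathcal N^w_{j=1728}$ are the weighted counts of the elliptic curves with $j=0$ (the $\mu_6$-twist family) and with $j=1728$ (the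 $\mu_4$-twist family), and $$\mathcal N^w_{j=0}(B)=\frac{q^5-1}{q^5-q^4}B^{1/2}+1,\qquad \mathcal N^w_{j=1728}(B)=\frac{q^3-1}{q^3-q^2}B^{1/3}+1.$$ -/

import Mathlib

open scoped Polynomial WithZero

noncomputable section

namespace EllCount

/-- The closed points of the projective line over `F`: the maximal ideals of `F[t]` and the point at
infinity. -/
inductive Place (F : Type*) [Field F]
  | finite (v : IsDedekindDomain.HeightOneSpectrum F[X])
  | infty

variable {F : Type*} [Field F]

open scoped Classical in
/-- The normalized discrete valuation of `F(t)` at a closed point, written multiplicatively: the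
value of `f` is `exp (-k)` when `f` vanishes to order `k`. -/
def Place.val : Place F → Valuation (RatFunc F) ℤᵐ⁰
  | .finite v => v.valuation (RatFunc F)
  | .infty => RatFunc.inftyValuation F

/-- The degree over `F` of the residue field of a closed point. -/
def Place.deg : Place F → ℕ
  | .finite v => Module.finrank F (F[X] ⧸ v.asIdeal)
  | .infty => 1

/-- The Weierstrass equation `W` has coefficients in the local ring at `p`. -/
def IsIntegralAt (p : Place F) (W : WeierstrassCurve (RatFunc F)) : Prop :=
  p.val W.a₁ ≤ 1 ∧ p.val W.a₂ ≤ 1 ∧ p.val W.a₃ ≤ 1 ∧ p.val W.a₄ ≤ 1 ∧ p.val W.a₆ ≤ 1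

/-- The order of vanishing at `p` of the minimal discriminant of `W`: the least order of vanishing
of the discriminant among the `p`-integral equations that are isomorphic to `W` over `F(t)`. -/
def minDiscOrd (p : Place F) (W : WeierstrassCurve (RatFunc F)) : ℕ :=
  sInf {k : ℕ | ∃ C : WeierstrassCurve.VariableChange (RatFunc F),
    IsIntegralAt p (C • W) ∧ p.val (C • W).Δ = WithZero.exp (-(k : ℤ))}

/-- The degree of the minimal discriminant divisor of `W` on the projective line. -/
def minDiscDegree (W : WeierstrassCurve (RatFunc F)) : ℕ :=
  ∑ᶠ p : Place F, p.deg * minDiscOrd p W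

/-- The largest `k` such that `W` becomes `p`-integral after a change of coordinates
`(x, y) = (u² x' + r, u³ y' + s u² x' + t)` with `u` vanishing to order `k` at `p`.
The changes of coordinates that attain it are those leading to a minimal model at `p`. -/
def minimizingOrd (p : Place F) (W : WeierstrassCurve (RatFunc F)) : ℤ :=
  sSup {k : ℤ | ∃ C : WeierstrassCurve.VariableChange (RatFunc F),
    IsIntegralAt p (C • W) ∧ p.val (C.u : RatFunc F) = WithZero.exp (-k)}

/-- The (Faltings, or stacky) height of `W`: the degree of the fundamental line bundle of its
minimal Weierstrass model over the projective line. The invariant differential of a minimal model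
at `p` is `u` times that of `W`, with `u` of order `minimizingOrd p W`, and the fundamental line
bundle is generated locally by the invariant differential of a minimal model. -/
def faltingsHeight (W : WeierstrassCurve (RatFunc F)) : ℤ :=
  -∑ᶠ p : Place F, (p.deg : ℤ) * minimizingOrd p W

variable (F) in
/-- Weierstrass equations over `F(t)` up to isomorphism over `F(t)`. -/
abbrev IsoClass : Type _ :=
  MulAction.orbitRel.Quotient (WeierstrassCurve.VariableChange (RatFunc F))
    (WeierstrassCurve (RatFunc F))

/-- The isomorphism classes over `F(t)` of the curves in `S`. -/
def isoClasses (S : Set (WeierstrassCurve (RatFunc F))) : Set (IsoClass F) :=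
  (fun W => (Quotient.mk _ W : IsoClass F)) '' S

/-- The order of the group of automorphisms over `F(t)` of a curve in the isomorphism class `c`. -/
def autCard (c : IsoClass F) : ℕ :=
  Nat.card (MulAction.stabilizer (WeierstrassCurve.VariableChange (RatFunc F)) (Quotient.out c))

/-- The number of isomorphism classes of the curves in `S`. -/
def count (S : Set (WeierstrassCurve (RatFunc F))) : ℕ :=
  (isoClasses S).ncard

/-- The number of isomorphism classes of the curves in `S`, each weighted by the reciprocal of the
order of its automorphism group. -/
def weightedCount (S : Set (WeierstrassCurve (RatFunc F))) : ℝ :=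
  ∑ᶠ c ∈ isoClasses S, ((autCard c : ℝ))⁻¹

variable (F) in
/-- The elliptic curves over `F(t)` with `ht(Δ) = q ^ deg Δ ≤ B`, for `Δ` the minimal discriminant
and `q` the number of elements of `F`. -/
def ellipticCurves (B : ℝ) : Set (WeierstrassCurve (RatFunc F)) :=
  {W | W.IsElliptic ∧ (Nat.card F : ℝ) ^ minDiscDegree W ≤ B}

variable (F) in
/-- The elliptic curves over `F(t)` with `j`-invariant `j₀` and `ht(Δ) ≤ B`. -/
def ellipticCurvesWithJ (j₀ : RatFunc F) (B : ℝ) : Set (WeierstrassCurve (RatFunc F)) :=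
  {W | W ∈ ellipticCurves F B ∧ ∃ _ : W.IsElliptic, W.j = j₀}

variable (F) in
/-- The Weierstrass equations over `F(t)` with at worst a node, that is, the `F(t)`-points of the
moduli stack of stable elliptic curves, of height `n` with `q ^ (12 n) ≤ B`. -/
def stableCurves (B : ℝ) : Set (WeierstrassCurve (RatFunc F)) :=
  {W | (W.Δ ≠ 0 ∨ W.c₄ ≠ 0) ∧ (Nat.card F : ℝ) ^ (12 * faltingsHeight W) ≤ B}

variable (F) in
/-- The nodal (`j = ∞`) ones among them: the quadratic twists of the nodal cubic. -/
def nodalCurves (B : ℝ) : Set (WeierstrassCurve (RatFunc F)) :=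
  {W | (W.Δ = 0 ∧ W.c₄ ≠ 0) ∧ (Nat.card F : ℝ) ^ (12 * faltingsHeight W) ≤ B}

variable (F) in
/-- `δ(x) = 1` if `x` divides `q - 1`, and `δ(x) = 0` otherwise. -/
def delta (x : ℕ) : ℝ :=
  if x ∣ Nat.card F - 1 then 1 else 0

end EllCount

end

/-! Since 2 and 3 are invertible, every smooth or nodal curve over F(t) has an equation y² = x³ + ax
+ b with polynomials a, b, not both zero, such that D⁴ ∣ a and D⁶ ∣ b only for constant D
(`exists_smul_eq_minimal`). Such an equation is minimal at every finite place, and it is unique up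
to (a, b) ↦ (c⁴a, c⁶b) with c ∈ Fˣ (`mem_range_constChange`). By the product formula the height is
read off at infinity: it is at most N exactly when deg a ≤ 4N and deg b ≤ 6N
(`faltingsHeight_nonneg_and_le_iff`). Since Δ scales by u⁻¹², the product formula also gives deg Δ =
12n (`minDiscDegree_eq`).

Orbit-stabilizer for Fˣ then shows that a weighted count is the number of minimal pairs in a degree
box divided by q - 1 (`IsInvariant.weightedCount_eq`).

Every nonzero pair is, in exactly one way, a minimal pair scaled by a monic D, and there are q^d
monic D of degree d. Hence, if T(N) counts the nonzero pairs of a family in the box N, the minimal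
ones in the box N + 1 number T(N + 1) - q T(N) (`ncard_minimal_add`). Each family has T(N) = q^(kN +
l) - 1, with (k, l) = (10, 2) for all pairs, (2, 1) for the nodal ones, (6, 1) for a = 0 and (4, 1)
for b = 0. The missing zero pair contributes q - 1 to the difference, hence the constant 1 in each
weighted count.

The automorphism group is {c : c²= 1}, of order 2, unless a = 0 or b = 0, where it is the group of
sixth or fourth roots of unity in F. Its order is then 2 + 4δ(6) or 2 + 2δ(4), and the excess over 2
gives the δ-terms of the unweighted count. -/

open scoped Polynomial WithZero

noncomputable section

namespace EllCount

variable {F : Type*} [Field F]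

/-! ### Counting minimal pairs of polynomials in degree boxes -/

section PolynomialPairs

open Polynomial

/-- The pair of coefficients of `y² = x³ + a x + b` after the substitution that multiplies `a` by
`D ^ 4` and `b` by `D ^ 6`. -/
def scale {R : Type*} [CommRing R] (D : R) (P : R × R) : R × R :=
  (D ^ 4 * P.1, D ^ 6 * P.2)

lemma scale_scale {R : Type*} [CommRing R] (D E : R) (P : R × R) :
    scale D (scale E P) = scale (D * E) P := by
  simp only [scale, Prod.mk.injEq]; constructor <;> ring

lemma scale_injective {R : Type*} [CommRing R] [IsDomain R] {D : R} (hD : D ≠ 0) :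
    Function.Injective (scale D) := by
  rintro ⟨a, b⟩ ⟨c, d⟩ h
  simpa [scale, hD] using h

lemma scale_eq_zero {R : Type*} [CommRing R] [IsDomain R] {D : R} (hD : D ≠ 0) {P : R × R} :
    scale D P = 0 ↔ P = 0 := by
  simp [scale, Prod.ext_iff, hD]

/-- No nonconstant polynomial can be scaled out of the pair. -/
def IsMinimalPair (P : F[X] × F[X]) : Prop :=
  ∀ D : F[X], D ^ 4 ∣ P.1 → D ^ 6 ∣ P.2 → IsUnit D

lemma IsMinimalPair.ne_zero {P : F[X] × F[X]} (h : IsMinimalPair P) : P ≠ 0 := by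
  rintro rfl
  exact not_isUnit_zero (h 0 (by simp) (by simp))

/-- A D of maximal degree among those that can be scaled out leaves a minimal quotient. The degrees
are bounded because one entry of the pair is nonzero. -/
lemma exists_scale_eq {P : F[X] × F[X]} (hP : P ≠ 0) :
    ∃ D : F[X], D.Monic ∧ ∃ Q, IsMinimalPair Q ∧ scale D Q = P := by
  have hbound : ∀ D : F[X], D ^ 4 ∣ P.1 → D ^ 6 ∣ P.2 →
      D ≠ 0 ∧ D.natDegree ≤ P.1.natDegree + P.2.natDegree := by
    intro D h1 h2
    have hD : D ≠ 0 := by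
      rintro rfl
      apply hP
      exact Prod.ext (by simpa using h1) (by simpa using h2)
    refine ⟨hD, ?_⟩
    by_cases h : P.1 = 0
    · have h' : P.2 ≠ 0 := fun h' => hP (Prod.ext h h')
      have := natDegree_le_of_dvd h2 h'
      rw [natDegree_pow] at this
      omega
    · have := natDegree_le_of_dvd h1 h
      rw [natDegree_pow] at this
      omega
  let p : ℕ → Prop := fun n => ∃ D : F[X], D ^ 4 ∣ P.1 ∧ D ^ 6 ∣ P.2 ∧ D.natDegree = n
  have hp0 : p 0 := ⟨1, by simp, by simp, by simp⟩
  classical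
  obtain ⟨D, h1, h2, hdeg⟩ : p (Nat.findGreatest p (P.1.natDegree + P.2.natDegree)) :=
    Nat.findGreatest_spec (Nat.zero_le _) hp0
  have hD := (hbound D h1 h2).1
  have hlc : C D.leadingCoeff⁻¹ ≠ 0 := by simpa using hD
  have hass : Associated D (D * C D.leadingCoeff⁻¹) :=
    associated_mul_unit_right _ _ (isUnit_C.2 (by simpa using hD))
  obtain ⟨A, hA⟩ := (hass.symm.pow_pow (n := 4)).dvd.trans h1
  obtain ⟨B, hB⟩ := (hass.symm.pow_pow (n := 6)).dvd.trans h2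
  refine ⟨_, monic_mul_leadingCoeff_inv hD, (A, B), ?_, Prod.ext hA.symm hB.symm⟩
  intro E hE1 hE2
  have h1' : (D * C D.leadingCoeff⁻¹ * E) ^ 4 ∣ P.1 := by
    rw [hA, mul_pow]; exact mul_dvd_mul_left _ hE1
  have h2' : (D * C D.leadingCoeff⁻¹ * E) ^ 6 ∣ P.2 := by
    rw [hB, mul_pow]; exact mul_dvd_mul_left _ hE2
  obtain ⟨hne, hle⟩ := hbound _ h1' h2'
  have hE : E ≠ 0 := right_ne_zero_of_mul hne
  have := Nat.le_findGreatest (P := p) hle ⟨_, h1', h2', rfl⟩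
  rw [← hdeg, natDegree_mul (mul_ne_zero hD hlc) hE, natDegree_mul hD hlc] at this
  rw [isUnit_iff_degree_eq_zero, degree_eq_natDegree hE]
  norm_cast
  omega

/-- After cancelling gcd(D, E), coprimality makes the fourth and sixth powers of each cofactor
divide the entries of the opposite pair, so minimality makes both cofactors units. -/
lemma associated_of_scale_eq {P Q : F[X] × F[X]} (hP : IsMinimalPair P) (hQ : IsMinimalPair Q)
    {D E : F[X]} (hD : D ≠ 0) (h : scale D P = scale E Q) : Associated D E := by
  have key : ∀ {P Q : F[X] × F[X]} {a b : F[X]}, IsMinimalPair Q → IsCoprime a b →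
      scale a P = scale b Q → IsUnit a := by
    intro P Q a b hQ hab h
    simp only [scale, Prod.mk.injEq] at h
    exact hQ a ((hab.pow (m := 4) (n := 4)).dvd_of_dvd_mul_left (Dvd.intro _ h.1))
      ((hab.pow (m := 6) (n := 6)).dvd_of_dvd_mul_left (Dvd.intro _ h.2))
  obtain ⟨g, d, e, hd, he, hcop⟩ : ∃ g d e : F[X], D = g * d ∧ E = g * e ∧ IsCoprime d e := by
    classical
    have hgcd := EuclideanDomain.gcd_eq_gcd_ab D E
    have hl := EuclideanDomain.gcd_dvd_left D E
    have hr := EuclideanDomain.gcd_dvd_right D E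
    generalize EuclideanDomain.gcdA D E = x at hgcd
    generalize EuclideanDomain.gcdB D E = y at hgcd
    generalize EuclideanDomain.gcd D E = g at hgcd hl hr
    obtain ⟨d, rfl⟩ := hl
    obtain ⟨e, rfl⟩ := hr
    refine ⟨g, d, e, rfl, rfl, x, y, mul_left_cancel₀ (left_ne_zero_of_mul hD) ?_⟩
    linear_combination -hgcd
  have hg : g ≠ 0 := by rintro rfl; simp at hd; exact hD hd
  rw [hd, he, ← scale_scale, ← scale_scale] at h
  have h' := scale_injective hg h
  rw [hd, he]
  exact Associated.mul_left _ ((associated_one_iff_isUnit.2 (key hQ hcop h')).trans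
    (associated_one_iff_isUnit.2 (key hP hcop.symm h'.symm)).symm)

variable (F) in
/-- The pairs with the degree bounds that correspond to a Weierstrass equation of height at most
`N`. -/
def degreeBox (N : ℕ) : Set (F[X] × F[X]) :=
  {P | P.1.natDegree ≤ 4 * N ∧ P.2.natDegree ≤ 6 * N}

lemma setOf_natDegree_le (n : ℕ) :
    {p : F[X] | p.natDegree ≤ n} = (degreeLT F (n + 1) : Set F[X]) := by
  ext p
  simp only [Set.mem_ofPred_eq, SetLike.mem_coe, mem_degreeLT, natDegree_le_iff_degree_le]
  exact ⟨fun h => h.trans_lt (by exact_mod_cast Nat.lt_succ_self n),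
    fun h => Order.le_of_lt_succ (by exact_mod_cast h)⟩

instance finite_degreeLT [Finite F] (n : ℕ) : Finite (degreeLT F n) := Finite.of_equiv _ (degreeLTEquiv F n).symm.toEquiv

lemma card_degreeLT (n : ℕ) : Nat.card (degreeLT F n) = Nat.card F ^ n := by
  rw [Nat.card_congr (degreeLTEquiv F n).toEquiv, Nat.card_fun]
  simp

/-- The bound on `D.natDegree` guards the truncated subtraction: for larger D the box on the right
would be the box 0, which contains constant pairs. -/
lemma scale_mem_degreeBox_iff {D : F[X]} (hD : D ≠ 0) {P : F[X] × F[X]} (hP : P ≠ 0) {N : ℕ} :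
    scale D P ∈ degreeBox F N ↔ D.natDegree ≤ N ∧ P ∈ degreeBox F (N - D.natDegree) := by
  obtain ⟨A, B⟩ := P
  simp only [scale, degreeBox, Set.mem_ofPred_eq]
  by_cases hA : A = 0 <;> by_cases hB : B = 0
  · simp [hA, hB] at hP
  all_goals
    simp [hA, hB, hD, natDegree_mul, natDegree_pow]
    omega

lemma ncard_natDegree_le (n : ℕ) :
    {p : F[X] | p.natDegree ≤ n}.ncard = Nat.card F ^ (n + 1) := by
  rw [setOf_natDegree_le, ← card_degreeLT]
  rfl

lemma card_monic_natDegree_eq (d : ℕ) :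
    Nat.card {p : F[X] // p.Monic ∧ p.natDegree = d} = Nat.card F ^ d := by
  rw [← card_degreeLT]
  refine (Nat.card_congr (Equiv.ofBijective
    (fun p : degreeLT F d => (⟨X ^ d + (p : F[X]), ?_, ?_⟩ :
      {p : F[X] // p.Monic ∧ p.natDegree = d})) ⟨?_, ?_⟩)).symm
  · exact monic_X_pow_add (mem_degreeLT.1 p.2)
  · exact natDegree_eq_of_degree_eq_some (by
      rw [degree_add_eq_left_of_degree_lt, degree_X_pow]
      rw [degree_X_pow]; exact mem_degreeLT.1 p.2)
  · intro p p' h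
    exact Subtype.ext (add_left_cancel (congrArg Subtype.val h))
  · rintro ⟨p, hm, rfl⟩
    refine ⟨⟨p - X ^ p.natDegree, mem_degreeLT.2 ?_⟩, by simp⟩
    rw [← degree_eq_natDegree hm.ne_zero]
    exact degree_sub_lt_left (by rw [degree_X_pow, degree_eq_natDegree hm.ne_zero]) hm.ne_zero
      (by simp [hm.leadingCoeff])

variable [Finite F]

lemma finite_natDegree_le (n : ℕ) : {p : F[X] | p.natDegree ≤ n}.Finite := by
  rw [setOf_natDegree_le]
  exact inferInstanceAs (Finite (degreeLT F (n + 1)))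

lemma finite_degreeBox (N : ℕ) : (degreeBox F N).Finite :=
  ((finite_natDegree_le (4 * N)).prod (finite_natDegree_le (6 * N))).subset fun _ h => h

instance finite_monic_natDegree_eq (d : ℕ) : Finite {p : F[X] // p.Monic ∧ p.natDegree = d} :=
  ((finite_natDegree_le d).subset fun _ h => h.2.le)

/-- Sorting the pairs by the largest monic polynomial that can be scaled out of them. -/
lemma ncard_inter_degreeBox {T : Set (F[X] × F[X])} (h0 : (0 : F[X] × F[X]) ∉ T)
    (hT : ∀ D : F[X], D ≠ 0 → ∀ P, scale D P ∈ T ↔ P ∈ T) (N : ℕ) :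
    (T ∩ degreeBox F N).ncard =
      ∑ d ∈ Finset.range (N + 1),
        Nat.card F ^ d * ((T ∩ degreeBox F (N - d)) ∩ {P | IsMinimalPair P}).ncard := by
  have hfin : ∀ n, Finite ((T ∩ degreeBox F n ∩ {P | IsMinimalPair P} : Set (F[X] × F[X]))) :=
    fun n => (finite_degreeBox n).subset fun _ h => h.1.2
  have e : (Σ d : Fin (N + 1), {p : F[X] // p.Monic ∧ p.natDegree = d} ×
      (T ∩ degreeBox F (N - d) ∩ {P | IsMinimalPair P} : Set (F[X] × F[X]))) ≃
      (T ∩ degreeBox F N : Set (F[X] × F[X])) := by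
    refine Equiv.ofBijective (fun x => ⟨scale x.2.1.1 x.2.2.1, ?_⟩) ⟨?_, ?_⟩
    · obtain ⟨d, ⟨p, hp, hd⟩, P, hP⟩ := x
      refine ⟨(hT p hp.ne_zero P).2 hP.1.1, (scale_mem_degreeBox_iff hp.ne_zero hP.2.ne_zero).2 ?_⟩
      rw [hd]
      exact ⟨Nat.lt_succ_iff.1 d.2, hP.1.2⟩
    · rintro ⟨d, ⟨p, hp, hd⟩, P, hP⟩ ⟨d', ⟨p', hp', hd'⟩, P', hP'⟩ h
      replace h : scale p P = scale p' P' := congrArg Subtype.val h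
      obtain rfl : p = p' := eq_of_monic_of_associated hp hp'
        (associated_of_scale_eq hP.2 hP'.2 hp.ne_zero h)
      obtain rfl : P = P' := scale_injective hp.ne_zero h
      obtain rfl : d = d' := Fin.ext (hd.symm.trans hd')
      rfl
    · rintro ⟨P, hPT, hPN⟩
      have hP0 : P ≠ 0 := by rintro rfl; exact h0 hPT
      obtain ⟨D, hD, Q, hQ, rfl⟩ := exists_scale_eq hP0
      have hbox := (scale_mem_degreeBox_iff hD.ne_zero hQ.ne_zero).1 hPN
      exact ⟨⟨⟨D.natDegree, Nat.lt_succ_iff.2 hbox.1⟩, ⟨D, hD, rfl⟩, Q,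
        ⟨(hT D hD.ne_zero Q).1 hPT, hbox.2⟩, hQ⟩, rfl⟩
  change Nat.card (T ∩ degreeBox F N : Set (F[X] × F[X])) = _
  rw [← Nat.card_congr e, Nat.card_sigma, ← Fin.sum_univ_eq_sum_range
    (fun d => Nat.card F ^ d * ((T ∩ degreeBox F (N - d)) ∩ {P | IsMinimalPair P}).ncard)]
  refine Finset.sum_congr rfl fun d _ => ?_
  rw [Nat.card_prod, card_monic_natDegree_eq]
  rfl

/-- The sum over d is a convolution with the coefficients q^d of 1/(1 - qX); multiplying the
generating series by 1 - qX isolates the minimal pairs. -/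
lemma ncard_minimal_add {T : Set (F[X] × F[X])} (h0 : (0 : F[X] × F[X]) ∉ T)
    (hT : ∀ D : F[X], D ≠ 0 → ∀ P, scale D P ∈ T ↔ P ∈ T) (N : ℕ) :
    ((T ∩ degreeBox F (N + 1)) ∩ {P | IsMinimalPair P}).ncard
      + Nat.card F * (T ∩ degreeBox F N).ncard = (T ∩ degreeBox F (N + 1)).ncard := by
  rw [ncard_inter_degreeBox h0 hT (N + 1), ncard_inter_degreeBox h0 hT N,
    Finset.sum_range_succ' _ (N + 1), add_comm, Finset.mul_sum]
  congr 1
  · refine Finset.sum_congr rfl fun d _ => ?_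
    rw [Nat.add_sub_add_right, pow_succ]
    ring
  · simp

/-- The number of minimal pairs in the degree box `N + 1`, in terms of a formula for all pairs. -/
lemma ncard_minimal_of_ncard {T : Set (F[X] × F[X])} (h0 : (0 : F[X] × F[X]) ∉ T)
    (hT : ∀ D : F[X], D ≠ 0 → ∀ P, scale D P ∈ T ↔ P ∈ T) (k l : ℕ)
    (h : ∀ N, (T ∩ degreeBox F N).ncard + 1 = Nat.card F ^ (k * N + l)) (N : ℕ) :
    (((T ∩ degreeBox F (N + 1)) ∩ {P | IsMinimalPair P}).ncard : ℝ) =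
      (Nat.card F : ℝ) ^ (k * (N + 1) + l) - (Nat.card F : ℝ) ^ (k * N + l + 1)
        + (Nat.card F - 1) := by
  have h1 : ((T ∩ degreeBox F (N + 1)).ncard : ℝ) + 1 = (Nat.card F : ℝ) ^ (k * (N + 1) + l) := by
    exact_mod_cast h (N + 1)
  have h2 : ((T ∩ degreeBox F N).ncard : ℝ) + 1 = (Nat.card F : ℝ) ^ (k * N + l) := by
    exact_mod_cast h N
  have h3 : (((T ∩ degreeBox F (N + 1)) ∩ {P | IsMinimalPair P}).ncard : ℝ)
      + Nat.card F * ((T ∩ degreeBox F N).ncard : ℝ) = ((T ∩ degreeBox F (N + 1)).ncard : ℝ) := by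
    exact_mod_cast ncard_minimal_add h0 hT N
  rw [pow_succ _ (k * N + l), ← h1, ← h2]
  linarith

lemma ncard_ne_zero_inter_degreeBox (N : ℕ) :
    ({P | P ≠ 0} ∩ degreeBox F N).ncard + 1 = Nat.card F ^ (10 * N + 2) := by
  have h : insert 0 ({P | P ≠ 0} ∩ degreeBox F N) =
      {p : F[X] | p.natDegree ≤ 4 * N} ×ˢ {p : F[X] | p.natDegree ≤ 6 * N} := by
    ext ⟨A, B⟩
    simp only [degreeBox, Set.mem_insert_iff, Set.mem_inter_iff, Set.mem_ofPred_eq, Set.mem_prod]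
    constructor
    · rintro (h | h)
      · simp only [Prod.mk_eq_zero] at h; simp [h]
      · exact h.2
    · tauto
  rw [← Set.ncard_insert_of_notMem (a := 0) (by simp) ((finite_degreeBox N).inter_of_right _), h,
    Set.ncard_prod, ncard_natDegree_le, ncard_natDegree_le, ← pow_add]
  congr 1; ring

/-- A family of pairs parametrized by the polynomials of degree at most `k * N`. -/
lemma ncard_of_param {T : Set (F[X] × F[X])} (f : F[X] → F[X] × F[X]) (hf0 : f 0 = 0)
    (hf : Function.Injective f) (hfT : ∀ P, P ∈ T ↔ P ≠ 0 ∧ P ∈ Set.range f) (k N : ℕ)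
    (hdeg : ∀ p, f p ∈ degreeBox F N ↔ p.natDegree ≤ k * N) :
    (T ∩ degreeBox F N).ncard + 1 = Nat.card F ^ (k * N + 1) := by
  have h : insert 0 (T ∩ degreeBox F N) = f '' {p : F[X] | p.natDegree ≤ k * N} := by
    ext P
    simp only [Set.mem_insert_iff, Set.mem_inter_iff, Set.mem_image, Set.mem_ofPred_eq]
    constructor
    · rintro (rfl | ⟨h, h'⟩)
      · exact ⟨0, by simp, hf0⟩
      · obtain ⟨_, p, rfl⟩ := (hfT P).1 h
        exact ⟨p, (hdeg p).1 h', rfl⟩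
    · rintro ⟨p, hp, rfl⟩
      by_cases h0 : f p = 0
      · exact Or.inl h0
      · exact Or.inr ⟨(hfT _).2 ⟨h0, p, rfl⟩, (hdeg p).2 hp⟩
  have h0 : (0 : F[X] × F[X]) ∉ T := fun h => ((hfT 0).1 h).1 rfl
  rw [← Set.ncard_insert_of_notMem (a := 0) (fun h => h0 h.1)
    ((finite_degreeBox N).inter_of_right _), h, Set.ncard_image_of_injective _ hf,
    ncard_natDegree_le]

lemma ncard_fst_eq_zero_inter_degreeBox (N : ℕ) :
    ({P | P ≠ 0 ∧ P.1 = 0} ∩ degreeBox F N).ncard + 1 = Nat.card F ^ (6 * N + 1) := by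
  refine ncard_of_param (fun p => (0, p)) rfl (Prod.mk_right_injective 0) (fun P => ?_) _ _
    (fun p => by simp [degreeBox])
  exact and_congr_right fun _ => ⟨fun h => ⟨P.2, by rw [← h]⟩, by rintro ⟨p, rfl⟩; rfl⟩

lemma ncard_snd_eq_zero_inter_degreeBox (N : ℕ) :
    ({P | P ≠ 0 ∧ P.2 = 0} ∩ degreeBox F N).ncard + 1 = Nat.card F ^ (4 * N + 1) := by
  refine ncard_of_param (fun p => (p, 0)) rfl (Prod.mk_left_injective 0) (fun P => ?_) _ _
    (fun p => by simp [degreeBox])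
  exact and_congr_right fun _ => ⟨fun h => ⟨P.1, by rw [← h]⟩, by rintro ⟨p, rfl⟩; rfl⟩

/-- A cubic x³ + ax + b with a double root s is (x - s)²(x + 2s), so a = -3s² and b = 2s³. The
parameter s is again a polynomial, and the box N becomes deg s ≤ 2N. -/
lemma ncard_disc_eq_zero_inter_degreeBox (h2 : (2 : F) ≠ 0) (h3 : (3 : F) ≠ 0) (N : ℕ) :
    ({P | P ≠ 0 ∧ 4 * P.1 ^ 3 + 27 * P.2 ^ 2 = 0} ∩ degreeBox F N).ncard + 1 =
      Nat.card F ^ (2 * N + 1) := by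
  have h2' : (C 2 : F[X]) ≠ 0 := by simpa using h2
  have h3' : (C 3 : F[X]) ≠ 0 := by simpa using h3
  have hC2 : (2 : F[X]) = C 2 := rfl
  have hC3 : (3 : F[X]) = C 3 := rfl
  rw [← hC2] at h2'
  rw [← hC3] at h3'
  refine ncard_of_param (fun s => (-3 * s ^ 2, 2 * s ^ 3)) (by simp) ?_ (fun P => ?_) _ _
    (fun p => ?_)
  · intro s t h
    simp only [Prod.mk.injEq, mul_right_inj' h2', neg_mul, neg_inj, mul_right_inj' h3'] at h
    by_cases ht : t = 0
    · simpa [ht] using h.1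
    · have : s * t ^ 2 = t * t ^ 2 := by linear_combination h.2 - s * h.1
      exact mul_right_cancel₀ (pow_ne_zero 2 ht) this
  · refine and_congr_right fun hP => ⟨fun h => ?_, ?_⟩
    · obtain ⟨A, B⟩ := P
      simp only at h
      have hunit2 : (2 : F[X]) * C 2⁻¹ = 1 := by rw [hC2, ← C_mul, mul_inv_cancel₀ h2, C_1]
      have hunit3 : (3 : F[X]) * C 3⁻¹ = 1 := by rw [hC3, ← C_mul, mul_inv_cancel₀ h3, C_1]
      generalize (C 2⁻¹ : F[X]) = i at hunit2
      generalize (C 3⁻¹ : F[X]) = j at hunit3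
      have hA : A ≠ 0 := by
        rintro rfl
        have h27 : (27 : F[X]) ≠ 0 := by
          have : (27 : F[X]) = 3 ^ 3 := by norm_num
          rw [this]; exact pow_ne_zero 3 h3'
        apply hP
        simpa [h27] using h
      -- From 27B² = -4A³; unique factorization then gives A ∣ B.
      have hdvd : A ^ 2 ∣ B ^ 2 := by
        refine ⟨-4 * j ^ 3 * A, ?_⟩
        linear_combination j ^ 3 * h - B ^ 2 * (9 * j ^ 2 + 3 * j + 1) * hunit3
      obtain ⟨c, rfl⟩ := (UniqueFactorizationMonoid.pow_dvd_pow_iff_dvd two_ne_zero).1 hdvd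
      have hc : 4 * A + 27 * c ^ 2 = 0 := by
        have : A ^ 2 * (4 * A + 27 * c ^ 2) = 0 := by linear_combination h
        exact (mul_eq_zero.1 this).resolve_left (pow_ne_zero 2 hA)
      have hAc : A = -27 * i ^ 2 * c ^ 2 := by
        linear_combination i ^ 2 * hc - A * (2 * i + 1) * hunit2
      -- Here i is 1/2 and c = B/A = -2s/3, so s = -3c/2.
      refine ⟨-3 * i * c, Prod.ext ?_ ?_⟩
      · change -3 * (-3 * i * c) ^ 2 = A
        rw [hAc]; ring
      · change 2 * (-3 * i * c) ^ 3 = A * c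
        rw [hAc]
        linear_combination -27 * i ^ 2 * c ^ 3 * hunit2
    · rintro ⟨s, rfl⟩
      ring
  · simp only [degreeBox, Set.mem_ofPred_eq]
    by_cases hp : p = 0
    · simp [hp]
    rw [natDegree_mul (by simpa using h3') (by simpa using hp),
      natDegree_mul (by simpa using h2') (by simpa using hp), natDegree_pow, natDegree_pow,
      natDegree_neg, hC2, hC3, natDegree_C, natDegree_C]
    omega

end PolynomialPairs

/-! ### Valuations of F(t) and the product formula -/

section Places

open Polynomial

/-- The order of vanishing at a closed point. -/
def Place.ord (p : Place F) (f : RatFunc F) : ℤ := -(p.val f).log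

lemma Place.val_eq_exp (p : Place F) {f : RatFunc F} (hf : f ≠ 0) :
    p.val f = WithZero.exp (-p.ord f) := by
  rw [Place.ord, neg_neg, WithZero.exp_log ((Valuation.ne_zero_iff _).2 hf)]

lemma Place.ord_eq_iff (p : Place F) {f : RatFunc F} (hf : f ≠ 0) {k : ℤ} :
    p.val f = WithZero.exp (-k) ↔ p.ord f = k := by
  rw [p.val_eq_exp hf, WithZero.exp_inj, neg_inj]

lemma Place.ord_mul (p : Place F) {f g : RatFunc F} (hf : f ≠ 0) (hg : g ≠ 0) :
    p.ord (f * g) = p.ord f + p.ord g := by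
  rw [Place.ord, map_mul, WithZero.log_mul ((Valuation.ne_zero_iff _).2 hf)
    ((Valuation.ne_zero_iff _).2 hg), neg_add]
  rfl

lemma Place.ord_inv (p : Place F) (f : RatFunc F) : p.ord f⁻¹ = -p.ord f := by
  rw [Place.ord, map_inv₀, WithZero.log_inv]
  rfl

lemma Place.val_infty_algebraMap {f : F[X]} (hf : f ≠ 0) :
    (Place.infty : Place F).val (algebraMap F[X] (RatFunc F) f) =
      WithZero.exp (f.natDegree : ℤ) := by
  classical
  exact RatFunc.inftyValuation.polynomial F hf

lemma Place.val_finite_algebraMap (v : IsDedekindDomain.HeightOneSpectrum F[X]) (f : F[X]) :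
    (Place.finite v).val (algebraMap F[X] (RatFunc F) f) = v.intValuation f :=
  v.valuation_of_algebraMap f

lemma Place.val_of_isUnit (p : Place F) {f : F[X]} (hf : IsUnit f) :
    p.val (algebraMap F[X] (RatFunc F) f) = 1 := by
  cases p with
  | finite v =>
    rw [val_finite_algebraMap, v.intValuation_eq_one_iff]
    exact fun h => v.isPrime.ne_top (Ideal.eq_top_of_isUnit_mem _ h hf)
  | infty => rw [val_infty_algebraMap hf.ne_zero, natDegree_eq_zero_of_isUnit hf]; rfl

lemma Place.exists_ord_eq (p : Place F) (k : ℤ) : ∃ f : RatFunc F, f ≠ 0 ∧ p.ord f = k := by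
  obtain ⟨π, hπ0, hπ⟩ : ∃ f : RatFunc F, f ≠ 0 ∧ p.val f = WithZero.exp (-k) := by
    cases p with
    | finite v =>
      obtain ⟨π, hπ⟩ := v.valuation_surjective (RatFunc F) (WithZero.exp (-k))
      refine ⟨π, ?_, hπ⟩
      rintro rfl
      rw [map_zero] at hπ
      exact WithZero.exp_ne_zero hπ.symm
    | infty =>
      classical
      exact ⟨RatFunc.X ^ (-k), zpow_ne_zero _ RatFunc.X_ne_zero,
        RatFunc.inftyValuation.X_zpow F (-k)⟩
  exact ⟨π, hπ0, (p.ord_eq_iff hπ0).1 hπ⟩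

/-- The product formula. -/
lemma finite_support_and_finsum_ord {f : RatFunc F} (hf : f ≠ 0) :
    (Function.support fun p : Place F => (p.deg : ℤ) * p.ord f).Finite ∧
      ∑ᶠ p : Place F, (p.deg : ℤ) * p.ord f = 0 := by
  have hmul : ∀ {f g : RatFunc F}, f ≠ 0 → g ≠ 0 →
      ((Function.support fun p : Place F => (p.deg : ℤ) * p.ord f).Finite ∧
        ∑ᶠ p : Place F, (p.deg : ℤ) * p.ord f = 0) →
      ((Function.support fun p : Place F => (p.deg : ℤ) * p.ord g).Finite ∧
        ∑ᶠ p : Place F, (p.deg : ℤ) * p.ord g = 0) →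
      ((Function.support fun p : Place F => (p.deg : ℤ) * p.ord (f * g)).Finite ∧
        ∑ᶠ p : Place F, (p.deg : ℤ) * p.ord (f * g) = 0) := by
    rintro f g hf hg ⟨hf1, hf2⟩ ⟨hg1, hg2⟩
    have he : (fun p : Place F => (p.deg : ℤ) * p.ord (f * g)) =
        fun p : Place F => (p.deg : ℤ) * p.ord f + (p.deg : ℤ) * p.ord g := by
      funext p
      rw [p.ord_mul hf hg, mul_add]
    rw [he]
    refine ⟨(hf1.union hg1).subset (Function.support_add _ _), ?_⟩
    rw [finsum_add_distrib hf1 hg1, hf2, hg2, add_zero]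
  have hinv : ∀ {f : RatFunc F},
      ((Function.support fun p : Place F => (p.deg : ℤ) * p.ord f).Finite ∧
        ∑ᶠ p : Place F, (p.deg : ℤ) * p.ord f = 0) →
      ((Function.support fun p : Place F => (p.deg : ℤ) * p.ord f⁻¹).Finite ∧
        ∑ᶠ p : Place F, (p.deg : ℤ) * p.ord f⁻¹ = 0) := by
    rintro f ⟨hf1, hf2⟩
    simp only [Place.ord_inv, mul_neg, finsum_neg_distrib, hf2, neg_zero, and_true]
    exact hf1.subset fun p hp => by simpa using hp
  have hpoly : ∀ g : F[X], g ≠ 0 →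
      (Function.support fun p : Place F =>
        (p.deg : ℤ) * p.ord (algebraMap F[X] (RatFunc F) g)).Finite ∧
      ∑ᶠ p : Place F, (p.deg : ℤ) * p.ord (algebraMap F[X] (RatFunc F) g) = 0 := by
    intro g
    induction g using UniqueFactorizationMonoid.induction_on_prime with
    | h₁ => simp
    | h₂ u hu =>
      intro _
      have : (fun p : Place F => (p.deg : ℤ) * p.ord (algebraMap F[X] (RatFunc F) u)) =
          fun _ => 0 := by
        funext p
        rw [Place.ord, p.val_of_isUnit hu]
        simp
      rw [this]
      simp
    -- A prime π has order 1 at the place (π), whose degree is deg π, order -deg π at infinity, and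
    -- order 0 elsewhere.
    | h₃ a π ha hπ ih =>
      intro _
      rw [map_mul]
      refine hmul (by simpa using hπ.ne_zero) (by simpa using ha) ?_ (ih ha)
      let v : IsDedekindDomain.HeightOneSpectrum F[X] :=
        ⟨Ideal.span {π}, (Ideal.span_singleton_prime hπ.ne_zero).2 hπ, by
          simpa using hπ.ne_zero⟩
      have hval : ∀ w : IsDedekindDomain.HeightOneSpectrum F[X], w ≠ v →
          (Place.finite w).ord (algebraMap F[X] (RatFunc F) π) = 0 := by
        intro w hw
        rw [Place.ord, Place.val_finite_algebraMap, w.intValuation_eq_one_iff.2]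
        · simp
        · intro hmem
          apply hw
          have hle : v.asIdeal ≤ w.asIdeal := by simpa [v, Ideal.span_le] using hmem
          exact IsDedekindDomain.HeightOneSpectrum.ext
            (v.isMaximal.eq_of_le w.isPrime.ne_top hle).symm
      have hsub : (Function.support fun p : Place F =>
          (p.deg : ℤ) * p.ord (algebraMap F[X] (RatFunc F) π)) ⊆
          {Place.finite v, Place.infty} := by
        intro p hp
        cases p with
        | finite w =>
          by_cases hw : w = v
          · simp [hw]
          · simp [hval w hw] at hp
        | infty => simp
      refine ⟨(Set.toFinite _).subset hsub, ?_⟩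
      classical
      have hv : (Place.finite v).ord (algebraMap F[X] (RatFunc F) π) = 1 := by
        rw [Place.ord, Place.val_finite_algebraMap, v.intValuation_singleton hπ.ne_zero rfl]
        simp
      have hi : (Place.infty : Place F).ord (algebraMap F[X] (RatFunc F) π) = -π.natDegree := by
        rw [Place.ord, Place.val_infty_algebraMap hπ.ne_zero, WithZero.log_exp]
      have hd : (Place.finite v).deg = π.natDegree := finrank_quotient_span_eq_natDegree
      rw [finsum_eq_sum_of_support_subset (s := {Place.finite v, Place.infty}) _ (by simpa using hsub),
        Finset.sum_pair (by simp), hv, hi, hd]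
      simp [Place.deg]
  rw [← RatFunc.num_div_denom f, div_eq_mul_inv]
  exact hmul (by simpa using hf) (by simpa using f.denom_ne_zero)
    (hpoly _ (RatFunc.num_ne_zero hf)) (hinv (hpoly _ f.denom_ne_zero))

/-! ### Integral models at a place -/

/-- The orders of vanishing at `p` of the `u` that lead to a `p`-integral equation. -/
def integralOrders (p : Place F) (W : WeierstrassCurve (RatFunc F)) : Set ℤ :=
  {k : ℤ | ∃ C : WeierstrassCurve.VariableChange (RatFunc F),
    IsIntegralAt p (C • W) ∧ p.val (C.u : RatFunc F) = WithZero.exp (-k)}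

/-- The factors u multiply under composition of changes of variables, so passing to an isomorphic
equation translates the set. -/
lemma add_mem_integralOrders_iff {p : Place F} {W : WeierstrassCurve (RatFunc F)}
    (C : WeierstrassCurve.VariableChange (RatFunc F)) {k : ℤ} :
    k + p.ord C.u ∈ integralOrders p W ↔ k ∈ integralOrders p (C • W) := by
  constructor
  · rintro ⟨C', h, h'⟩
    refine ⟨C' * C⁻¹, ?_, ?_⟩
    · rwa [← mul_smul, inv_mul_cancel_right]
    · rw [Place.ord_eq_iff _ (Units.ne_zero _)] at h' ⊢
      change p.ord ((C'.u * C.u⁻¹ : (RatFunc F)ˣ) : RatFunc F) = k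
      rw [Units.val_mul, p.ord_mul (Units.ne_zero _) (Units.ne_zero _), Units.val_inv_eq_inv_val,
        p.ord_inv, h']
      ring
  · rintro ⟨C', h, h'⟩
    refine ⟨C' * C, by rwa [mul_smul], ?_⟩
    rw [Place.ord_eq_iff _ (Units.ne_zero _)] at h' ⊢
    change p.ord ((C'.u * C.u : (RatFunc F)ˣ) : RatFunc F) = _
    rw [Units.val_mul, p.ord_mul (Units.ne_zero _) (Units.ne_zero _), h']

/-- The invariants are integer polynomials in the coefficients, so they can be computed over the
valuation ring. -/
lemma IsIntegralAt.val_c₄_le {p : Place F} {W : WeierstrassCurve (RatFunc F)}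
    (h : IsIntegralAt p W) : p.val W.c₄ ≤ 1 ∧ p.val W.c₆ ≤ 1 ∧ p.val W.Δ ≤ 1 := by
  obtain ⟨W', rfl⟩ : ∃ W' : WeierstrassCurve p.val.integer, W'.map p.val.integer.subtype = W :=
    ⟨⟨⟨_, h.1⟩, ⟨_, h.2.1⟩, ⟨_, h.2.2.1⟩, ⟨_, h.2.2.2.1⟩, ⟨_, h.2.2.2.2⟩⟩, rfl⟩
  rw [WeierstrassCurve.map_c₄, WeierstrassCurve.map_c₆, WeierstrassCurve.map_Δ]
  exact ⟨W'.c₄.2, W'.c₆.2, W'.Δ.2⟩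

/-- The curve `y² = x³ + a x + b`. -/
def shortCurve (P : RatFunc F × RatFunc F) : WeierstrassCurve (RatFunc F) :=
  ⟨0, 0, 0, P.1, P.2⟩

/-- The pair of coefficients as rational functions. -/
def ratPair (P : F[X] × F[X]) : RatFunc F × RatFunc F :=
  (algebraMap _ _ P.1, algebraMap _ _ P.2)

instance (P : RatFunc F × RatFunc F) : (shortCurve P).IsShortNF := ⟨rfl, rfl, rfl⟩

lemma smul_shortCurve_of_unit (u : (RatFunc F)ˣ) (P : RatFunc F × RatFunc F) :
    (⟨u, 0, 0, 0⟩ : WeierstrassCurve.VariableChange (RatFunc F)) • shortCurve P =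
      shortCurve (scale (↑u⁻¹) P) := by
  rw [WeierstrassCurve.variableChange_def]
  simp [shortCurve, scale]

lemma natCast_ne_zero_ratFunc {n : ℕ} (hn : (n : F) ≠ 0) : (n : RatFunc F) ≠ 0 := by
  simpa only [map_natCast] using (map_ne_zero (algebraMap F (RatFunc F))).2 hn

lemma Place.val_natCast (p : Place F) {n : ℕ} (hn : (n : F) ≠ 0) : p.val (n : RatFunc F) = 1 := by
  simpa only [map_natCast] using p.val_of_isUnit (isUnit_C.2 (isUnit_iff_ne_zero.2 hn))

lemma isGreatest_minimizingOrd_of_exists {p : Place F} {W : WeierstrassCurve (RatFunc F)}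
    (h : ∃ k, IsGreatest (integralOrders p W) k) :
    IsGreatest (integralOrders p W) (minimizingOrd p W) := by
  obtain ⟨k, hk⟩ := h
  have : minimizingOrd p W = k := hk.csSup_eq
  rwa [this]

lemma isGreatest_add_ord {p : Place F} {W : WeierstrassCurve (RatFunc F)}
    {C : WeierstrassCurve.VariableChange (RatFunc F)} {k : ℤ}
    (h : IsGreatest (integralOrders p (C • W)) k) :
    IsGreatest (integralOrders p W) (k + p.ord C.u) := by
  refine ⟨(add_mem_integralOrders_iff C).2 h.1, fun z hz => ?_⟩
  have : z - p.ord C.u ≤ k := h.2 ((add_mem_integralOrders_iff C).1 (by simpa using hz))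
  linarith

/-! ### Minimal models and heights when 2 and 3 are invertible -/

section CharNeTwoThree

variable (h2 : (2 : F) ≠ 0) (h3 : (3 : F) ≠ 0)

include h2 h3

lemma exists_smul_eq_shortCurve (W : WeierstrassCurve (RatFunc F)) :
    ∃ (C : WeierstrassCurve.VariableChange (RatFunc F)) (P : RatFunc F × RatFunc F),
      C • W = shortCurve P := by
  let : Invertible (2 : RatFunc F) := invertibleOfNonzero (natCast_ne_zero_ratFunc (n := 2) h2)
  let : Invertible (3 : RatFunc F) := invertibleOfNonzero (natCast_ne_zero_ratFunc (n := 3) h3)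
  obtain ⟨C, hC⟩ := W.exists_variableChange_isShortNF
  refine ⟨C, ((C • W).a₄, (C • W).a₆), ?_⟩
  ext <;> simp [shortCurve]

lemma eq_of_smul_shortCurve_eq {C : WeierstrassCurve.VariableChange (RatFunc F)}
    {P Q : RatFunc F × RatFunc F} (h : C • shortCurve P = shortCurve Q) :
    C = ⟨C.u, 0, 0, 0⟩ := by
  have h2' : (2 : RatFunc F) ≠ 0 := natCast_ne_zero_ratFunc (n := 2) h2
  have h3' : (3 : RatFunc F) ≠ 0 := natCast_ne_zero_ratFunc (n := 3) h3
  have e1 := congrArg WeierstrassCurve.a₁ h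
  have e2 := congrArg WeierstrassCurve.a₂ h
  have e3 := congrArg WeierstrassCurve.a₃ h
  rw [WeierstrassCurve.variableChange_a₁] at e1
  rw [WeierstrassCurve.variableChange_a₂] at e2
  rw [WeierstrassCurve.variableChange_a₃] at e3
  have hs : C.s = 0 := by simpa [shortCurve, h2'] using e1
  have ht : C.t = 0 := by simpa [shortCurve, h2'] using e3
  have hr : C.r = 0 := by simpa [shortCurve, h3', hs] using e2
  ext <;> simp [hs, ht, hr]

/-- An integral model has integral c₄ and c₆. For a short equation these are -48a and -864b, with
constants that are units at p, so they bound a and b. Conversely, any u of order k gives an integral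
short equation. -/
lemma mem_integralOrders_shortCurve {p : Place F} {P : RatFunc F × RatFunc F} {k : ℤ} :
    k ∈ integralOrders p (shortCurve P) ↔
      p.val P.1 ≤ WithZero.exp (-(4 * k)) ∧ p.val P.2 ≤ WithZero.exp (-(6 * k)) := by
  have hexp : ∀ {u a : RatFunc F} {n : ℕ}, p.val u = WithZero.exp (-k) →
      (p.val (u⁻¹ ^ n * a) ≤ 1 ↔ p.val a ≤ WithZero.exp (-(n * k))) := by
    intro u a n hu
    rw [map_mul, map_pow, map_inv₀, hu, ← WithZero.exp_neg, ← WithZero.exp_nsmul,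
      ← mul_le_mul_iff_of_pos_left (WithZero.exp_pos (a := -(n * k)) : (0 : ℤᵐ⁰) < _), ← mul_assoc,
      ← WithZero.exp_add]
    simp
  constructor
  · rintro ⟨C, hint, hu⟩
    have hv2 : p.val 2 = 1 := p.val_natCast (n := 2) h2
    have hv3 : p.val 3 = 1 := p.val_natCast (n := 3) h3
    obtain ⟨h4, h6, -⟩ := hint.val_c₄_le
    rw [WeierstrassCurve.variableChange_c₄, WeierstrassCurve.c₄_of_isShortNF,
      Units.val_inv_eq_inv_val, hexp hu, map_mul, Valuation.map_neg,
      show (48 : RatFunc F) = 2 ^ 4 * 3 by norm_num, map_mul, map_pow, hv2, hv3] at h4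
    rw [WeierstrassCurve.variableChange_c₆, WeierstrassCurve.c₆_of_isShortNF,
      Units.val_inv_eq_inv_val, hexp hu, map_mul, Valuation.map_neg,
      show (864 : RatFunc F) = 2 ^ 5 * 3 ^ 3 by norm_num, map_mul, map_pow, map_pow, hv2,
      hv3] at h6
    simpa [shortCurve] using And.intro h4 h6
  · rintro ⟨h4, h6⟩
    obtain ⟨u, hu0, hu⟩ := p.exists_ord_eq k
    rw [← p.ord_eq_iff hu0] at hu
    refine ⟨⟨Units.mk0 u hu0, 0, 0, 0⟩, ?_, hu⟩
    rw [smul_shortCurve_of_unit]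
    refine ⟨by simp [shortCurve], by simp [shortCurve], by simp [shortCurve], ?_, ?_⟩
    · exact (hexp (n := 4) hu).2 h4
    · exact (hexp (n := 6) hu).2 h6

/-- `minimizingOrd` is a supremum in ℤ, meaningful only for a nonempty set that is bounded above.
The nonzero entry of the pair supplies the upper bound. -/
lemma exists_isGreatest_integralOrders_shortCurve (p : Place F) {P : RatFunc F × RatFunc F}
    (hP : P ≠ 0) : ∃ k, IsGreatest (integralOrders p (shortCurve P)) k := by
  have key : ∀ {f : RatFunc F} (hf : f ≠ 0) {n : ℤ},
      p.val f ≤ WithZero.exp (-n) ↔ n ≤ p.ord f := by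
    intro f hf n
    rw [p.val_eq_exp hf, WithZero.exp_le_exp, neg_le_neg_iff]
  have hlow : ∃ k, k ∈ integralOrders p (shortCurve P) := by
    refine ⟨-(|p.ord P.1| + |p.ord P.2|), (mem_integralOrders_shortCurve h2 h3).2 ⟨?_, ?_⟩⟩
    · by_cases h : P.1 = 0
      · simp [h]
      · rw [key h]
        have := neg_abs_le (p.ord P.1)
        have := abs_nonneg (p.ord P.2)
        have := abs_nonneg (p.ord P.1)
        linarith
    · by_cases h : P.2 = 0
      · simp [h]
      · rw [key h]
        have := neg_abs_le (p.ord P.2)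
        have := abs_nonneg (p.ord P.2)
        have := abs_nonneg (p.ord P.1)
        linarith
  have hup : ∃ b : ℤ, ∀ z : ℤ, z ∈ integralOrders p (shortCurve P) → z ≤ b := by
    refine ⟨|p.ord P.1| + |p.ord P.2|, fun z hz => ?_⟩
    obtain ⟨h4, h6⟩ := (mem_integralOrders_shortCurve h2 h3).1 hz
    have a1 := abs_nonneg (p.ord P.1)
    have a2 := abs_nonneg (p.ord P.2)
    by_cases h : P.1 = 0
    · rw [key fun h' => hP (Prod.ext h h')] at h6
      have := le_abs_self (p.ord P.2)
      omega
    · rw [key h] at h4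
      have := le_abs_self (p.ord P.1)
      omega
  obtain ⟨k, hk, hk'⟩ := Int.exists_greatest_of_bdd hup hlow
  exact ⟨k, hk, fun z hz => hk' z hz⟩

/-- A positive k would allow a generator of the prime ideal to be scaled out of the pair. -/
lemma isGreatest_finite_of_isMinimalPair (v : IsDedekindDomain.HeightOneSpectrum F[X])
    {Q : F[X] × F[X]} (hQ : IsMinimalPair Q) :
    IsGreatest (integralOrders (.finite v) (shortCurve (ratPair Q))) 0 := by
  constructor
  · rw [mem_integralOrders_shortCurve h2 h3]
    simp only [ratPair, Place.val_finite_algebraMap]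
    exact ⟨v.intValuation_le_one _, v.intValuation_le_one _⟩
  · intro k hk
    by_contra! hk0
    obtain ⟨h4, h6⟩ := (mem_integralOrders_shortCurve h2 h3).1 hk
    obtain ⟨π, hπ⟩ := (IsPrincipalIdealRing.principal v.asIdeal).principal
    replace hπ : v.asIdeal = Ideal.span {π} := hπ
    have hdvd : ∀ {f : F[X]} {n : ℕ},
        (Place.finite v).val (algebraMap F[X] (RatFunc F) f) ≤ WithZero.exp (-(n * k)) →
          π ^ n ∣ f := by
      intro f n h
      rw [Place.val_finite_algebraMap] at h
      have h' : v.intValuation f ≤ WithZero.exp (-(n : ℤ)) := by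
        refine h.trans (WithZero.exp_le_exp.2 ?_)
        nlinarith
      rwa [v.intValuation_le_pow_iff_mem, hπ, Ideal.span_singleton_pow,
        Ideal.mem_span_singleton] at h'
    have hu := hQ π (hdvd (n := 4) h4) (hdvd (n := 6) h6)
    exact v.isPrime.ne_top (hπ ▸ Ideal.span_singleton_eq_top.2 hu)

/-- The order at infinity is minus the degree, so the local condition there is a degree box of size
-k. -/
lemma mem_integralOrders_infty {Q : F[X] × F[X]} (hQ : Q ≠ 0) {k : ℤ} :
    k ∈ integralOrders .infty (shortCurve (ratPair Q)) ↔
      k ≤ 0 ∧ Q ∈ degreeBox F (-k).toNat := by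
  have key : ∀ (f : F[X]) (n : ℤ),
      (Place.infty : Place F).val (algebraMap F[X] (RatFunc F) f) ≤ WithZero.exp (-n) ↔
        f = 0 ∨ n ≤ -f.natDegree := by
    intro f n
    by_cases hf : f = 0
    · simp [hf]
    · rw [Place.val_infty_algebraMap hf, WithZero.exp_le_exp]
      simp only [hf, false_or]
      omega
  rw [mem_integralOrders_shortCurve h2 h3]
  simp only [ratPair, key, degreeBox, Set.mem_ofPred_eq]
  by_cases hA : Q.1 = 0 <;> by_cases hB : Q.2 = 0
  · exact absurd (Prod.ext hA hB) hQ
  all_goals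
    simp only [hA, hB, true_or, false_or, true_and, and_true, natDegree_zero]
    omega

/-- A globally minimal equation. -/
lemma exists_smul_eq_minimal {W : WeierstrassCurve (RatFunc F)} (hW : W.Δ ≠ 0 ∨ W.c₄ ≠ 0) :
    ∃ (C : WeierstrassCurve.VariableChange (RatFunc F)) (Q : F[X] × F[X]),
      IsMinimalPair Q ∧ C • W = shortCurve (ratPair Q) := by
  obtain ⟨C, P, hC⟩ := exists_smul_eq_shortCurve h2 h3 W
  have hP : P ≠ 0 := by
    rintro rfl
    have h4 : (C • W).c₄ = 0 := by rw [hC, WeierstrassCurve.c₄_of_isShortNF]; simp [shortCurve]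
    have hD : (C • W).Δ = 0 := by rw [hC, WeierstrassCurve.Δ_of_isShortNF]; simp [shortCurve]
    rw [WeierstrassCurve.variableChange_c₄] at h4
    rw [WeierstrassCurve.variableChange_Δ] at hD
    simp at h4 hD
    tauto
  let d : F[X] := P.1.denom * P.2.denom
  have hd : d ≠ 0 := mul_ne_zero P.1.denom_ne_zero P.2.denom_ne_zero
  have hd' : algebraMap F[X] (RatFunc F) d ≠ 0 := by simpa using hd
  have h1 : algebraMap F[X] (RatFunc F) P.1.denom * P.1 = algebraMap F[X] (RatFunc F) P.1.num := by
    nth_rw 2 [← RatFunc.num_div_denom P.1]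
    rw [mul_div_cancel₀]
    simpa using P.1.denom_ne_zero
  have h1' : algebraMap F[X] (RatFunc F) P.2.denom * P.2 = algebraMap F[X] (RatFunc F) P.2.num := by
    nth_rw 2 [← RatFunc.num_div_denom P.2]
    rw [mul_div_cancel₀]
    simpa using P.2.denom_ne_zero
  -- These are d⁴ P.1 and d⁶ P.2 with one denominator cancelled against its power.
  let R : F[X] × F[X] := (P.1.denom ^ 3 * P.2.denom ^ 4 * P.1.num,
    P.1.denom ^ 6 * P.2.denom ^ 5 * P.2.num)
  have hR : scale (algebraMap F[X] (RatFunc F) d) P = ratPair R := by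
    simp only [scale, ratPair, R, d, map_mul, map_pow, ← h1, ← h1', Prod.mk.injEq]
    constructor <;> ring
  have hR0 : R ≠ 0 := by
    intro h
    rw [h] at hR
    exact hP ((scale_eq_zero hd').1 (hR.trans (by simp [ratPair])))
  obtain ⟨D, hD, Q, hQ, hDQ⟩ := exists_scale_eq hR0
  have hD' : algebraMap F[X] (RatFunc F) D ≠ 0 := by simpa using hD.ne_zero
  -- With u = D/d, the action scales P by d/D: it clears denominators and then removes D.
  refine ⟨⟨Units.mk0 _ hD' * (Units.mk0 _ hd')⁻¹, 0, 0, 0⟩ * C, Q, hQ, ?_⟩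
  rw [mul_smul, hC, smul_shortCurve_of_unit]
  congr 1
  apply scale_injective hD'
  rw [scale_scale]
  have : algebraMap F[X] (RatFunc F) D *
      ((Units.mk0 _ hD' * (Units.mk0 _ hd')⁻¹)⁻¹ : (RatFunc F)ˣ) = algebraMap _ _ d := by
    rw [mul_inv, inv_inv, Units.val_mul, Units.val_inv_eq_inv_val, Units.val_mk0, Units.val_mk0]
    field_simp
  rw [this, hR, ← hDQ]
  simp [scale, ratPair]

lemma exists_isGreatest_integralOrders (p : Place F) {W : WeierstrassCurve (RatFunc F)}
    (hW : W.Δ ≠ 0 ∨ W.c₄ ≠ 0) : IsGreatest (integralOrders p W) (minimizingOrd p W) := by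
  obtain ⟨C, Q, hQ, hC⟩ := exists_smul_eq_minimal h2 h3 hW
  obtain ⟨k, hk⟩ := exists_isGreatest_integralOrders_shortCurve h2 h3 p (P := ratPair Q) (by
    have := hQ.ne_zero
    simpa [ratPair, Prod.ext_iff] using this)
  rw [← hC] at hk
  exact isGreatest_minimizingOrd_of_exists ⟨_, isGreatest_add_ord hk⟩

/-- Passing from W to its minimal equation changes the local terms by the orders of u, which sum to
zero by the product formula. The minimal equation contributes only at infinity. -/
lemma finite_support_and_finsum_minimizingOrd {W : WeierstrassCurve (RatFunc F)}
    {C : WeierstrassCurve.VariableChange (RatFunc F)} {Q : F[X] × F[X]} (hQ : IsMinimalPair Q)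
    (hC : C • W = shortCurve (ratPair Q)) :
    (Function.support fun p : Place F => (p.deg : ℤ) * minimizingOrd p W).Finite ∧
      faltingsHeight W = -minimizingOrd .infty (shortCurve (ratPair Q)) := by
  have hQ0 : ratPair Q ≠ 0 := by
    have := hQ.ne_zero
    simpa [ratPair, Prod.ext_iff] using this
  have h1 : ∀ p : Place F, minimizingOrd p W =
      minimizingOrd p (shortCurve (ratPair Q)) + p.ord C.u := fun p =>
    (isGreatest_add_ord (C := C) (by
      rw [hC]
      exact isGreatest_minimizingOrd_of_exists
        (exists_isGreatest_integralOrders_shortCurve h2 h3 p hQ0))).csSup_eq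
  have h0 : ∀ p : Place F, p ≠ .infty → minimizingOrd p (shortCurve (ratPair Q)) = 0 := by
    intro p hp
    cases p with
    | finite v => exact (isGreatest_finite_of_isMinimalPair h2 h3 v hQ).csSup_eq
    | infty => exact absurd rfl hp
  have hsupp : (Function.support fun p : Place F =>
      (p.deg : ℤ) * minimizingOrd p (shortCurve (ratPair Q))) ⊆ {Place.infty} := by
    intro p hp
    by_contra h
    simp [h0 p h] at hp
  have he : (fun p : Place F => (p.deg : ℤ) * minimizingOrd p W) = fun p =>
      (p.deg : ℤ) * minimizingOrd p (shortCurve (ratPair Q)) + (p.deg : ℤ) * p.ord C.u := by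
    funext p
    rw [h1, mul_add]
  have hprod := finite_support_and_finsum_ord (F := F) (f := C.u) (Units.ne_zero _)
  have hfin := (Set.finite_singleton _).subset hsupp
  rw [faltingsHeight, he]
  refine ⟨(hfin.union hprod.1).subset (Function.support_add _ _), ?_⟩
  rw [finsum_add_distrib hfin hprod.1, hprod.2, add_zero,
    finsum_eq_single _ Place.infty fun p hp => by rw [h0 p hp, mul_zero]]
  simp [Place.deg]

lemma faltingsHeight_nonneg_and_le_iff {W : WeierstrassCurve (RatFunc F)}
    {C : WeierstrassCurve.VariableChange (RatFunc F)} {Q : F[X] × F[X]} (hQ : IsMinimalPair Q)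
    (hC : C • W = shortCurve (ratPair Q)) :
    0 ≤ faltingsHeight W ∧ ∀ N : ℕ, faltingsHeight W ≤ N ↔ Q ∈ degreeBox F N := by
  rw [(finite_support_and_finsum_minimizingOrd h2 h3 hQ hC).2]
  have hQ0 : ratPair Q ≠ 0 := by
    have := hQ.ne_zero
    simpa [ratPair, Prod.ext_iff] using this
  have hg := isGreatest_minimizingOrd_of_exists
    (exists_isGreatest_integralOrders_shortCurve h2 h3 .infty hQ0)
  generalize minimizingOrd Place.infty (shortCurve (ratPair Q)) = k at hg
  obtain ⟨hk0, hk⟩ := (mem_integralOrders_infty h2 h3 hQ.ne_zero).1 hg.1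
  refine ⟨by omega, fun N => ⟨fun h => ?_, fun h => ?_⟩⟩
  · simp only [degreeBox, Set.mem_ofPred_eq] at hk ⊢
    omega
  · have := hg.2 ((mem_integralOrders_infty h2 h3 hQ.ne_zero (k := -(N : ℤ))).2
      ⟨by omega, by simpa using h⟩)
    omega

/-- Δ is multiplied by u⁻¹², so its order is least exactly when that of u is greatest. -/
lemma minDiscOrd_eq (p : Place F) {W : WeierstrassCurve (RatFunc F)} (hW : W.Δ ≠ 0) :
    (minDiscOrd p W : ℤ) = p.ord W.Δ - 12 * minimizingOrd p W := by
  have hg := exists_isGreatest_integralOrders h2 h3 p (Or.inl hW)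
  have hΔ : ∀ C : WeierstrassCurve.VariableChange (RatFunc F),
      (C • W).Δ ≠ 0 ∧ p.ord (C • W).Δ = p.ord W.Δ - 12 * p.ord C.u := by
    intro C
    have hpow : p.ord ((C.u : RatFunc F)⁻¹ ^ 12) = 12 * p.ord (C.u : RatFunc F)⁻¹ := by
      rw [Place.ord, map_pow, WithZero.log_pow, Place.ord]
      simp
    rw [WeierstrassCurve.variableChange_Δ, Units.val_inv_eq_inv_val]
    have hu : (C.u : RatFunc F)⁻¹ ^ 12 ≠ 0 := pow_ne_zero _ (inv_ne_zero (Units.ne_zero _))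
    refine ⟨mul_ne_zero hu hW, ?_⟩
    rw [p.ord_mul hu hW, hpow, p.ord_inv]
    ring
  obtain ⟨⟨C, hint, hu⟩, hmax⟩ := hg
  rw [p.ord_eq_iff (Units.ne_zero _)] at hu
  have hnonneg : 0 ≤ p.ord (C • W).Δ := by
    have := hint.val_c₄_le.2.2
    rw [p.val_eq_exp (hΔ C).1, ← WithZero.exp_zero, WithZero.exp_le_exp] at this
    omega
  have hleast : IsLeast {k : ℕ | ∃ C : WeierstrassCurve.VariableChange (RatFunc F),
      IsIntegralAt p (C • W) ∧ p.val (C • W).Δ = WithZero.exp (-(k : ℤ))}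
      (p.ord (C • W).Δ).toNat := by
    constructor
    · refine ⟨C, hint, ?_⟩
      rw [p.ord_eq_iff (hΔ C).1, Int.toNat_of_nonneg hnonneg]
    · rintro k ⟨C', hint', hk⟩
      rw [p.ord_eq_iff (hΔ C').1, (hΔ C').2] at hk
      have hle : p.ord C'.u ≤ minimizingOrd p W :=
        hmax ⟨C', hint', (p.ord_eq_iff (Units.ne_zero _)).2 rfl⟩
      have := (hΔ C).2
      omega
  rw [minDiscOrd, hleast.csInf_eq, Int.toNat_of_nonneg hnonneg, (hΔ C).2, hu]

lemma minDiscDegree_eq {W : WeierstrassCurve (RatFunc F)} (hW : W.Δ ≠ 0) :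
    (minDiscDegree W : ℤ) = 12 * faltingsHeight W := by
  obtain ⟨C, Q, hQ, hC⟩ := exists_smul_eq_minimal h2 h3 (Or.inl hW)
  have hfin := (finite_support_and_finsum_minimizingOrd h2 h3 hQ hC).1
  have hprod := finite_support_and_finsum_ord hW
  have he : (fun p : Place F => ((p.deg * minDiscOrd p W : ℕ) : ℤ)) = fun p =>
      (p.deg : ℤ) * p.ord W.Δ - 12 * ((p.deg : ℤ) * minimizingOrd p W) := by
    funext p
    rw [Nat.cast_mul, minDiscOrd_eq h2 h3 p hW]
    ring
  have hfin12 : (Function.support fun p : Place F =>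
      12 * ((p.deg : ℤ) * minimizingOrd p W)).Finite :=
    hfin.subset fun p hp => right_ne_zero_of_mul hp
  have hsupp : (Function.support fun p : Place F => p.deg * minDiscOrd p W).Finite := by
    have : (Function.support fun p : Place F => ((p.deg * minDiscOrd p W : ℕ) : ℤ)).Finite := by
      rw [he]
      exact (hprod.1.union hfin12).subset (Function.support_sub _ _)
    exact this.subset fun p hp => by simpa using hp
  have hcast : (minDiscDegree W : ℤ) = ∑ᶠ p : Place F, ((p.deg * minDiscOrd p W : ℕ) : ℤ) :=
    (Nat.castAddMonoidHom ℤ).map_finsum hsupp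
  rw [hcast, he, finsum_sub_distrib hprod.1 hfin12, hprod.2, ← mul_finsum, faltingsHeight]
  ring

end CharNeTwoThree

end Places

/-! ### From isomorphism classes to minimal equations -/

section Classes

open Polynomial MulAction

/-- The changes of variables `(x, y) ↦ (a² x, a³ y)` for a nonzero constant `a`. -/
def constChange : Fˣ →* WeierstrassCurve.VariableChange (RatFunc F) where
  toFun a := ⟨Units.map (algebraMap F (RatFunc F)).toMonoidHom a, 0, 0, 0⟩
  map_one' := by rw [map_one]; rfl
  map_mul' a b := by
    rw [map_mul, WeierstrassCurve.VariableChange.mul_def]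
    simp

lemma constChange_injective : Function.Injective (constChange (F := F)) := by
  intro a b h
  have h' := congrArg (fun C : WeierstrassCurve.VariableChange (RatFunc F) => (C.u : RatFunc F)) h
  exact Units.ext ((algebraMap F (RatFunc F)).injective h')

lemma constChange_smul (a : Fˣ) (Q : F[X] × F[X]) :
    constChange a • shortCurve (ratPair Q) = shortCurve (ratPair (scale (C (↑a⁻¹ : F)) Q)) := by
  change (⟨_, 0, 0, 0⟩ : WeierstrassCurve.VariableChange (RatFunc F)) • _ = _
  rw [smul_shortCurve_of_unit, ← map_inv]
  congr 1
  simp [scale, ratPair, RatFunc.algebraMap_eq_C]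

lemma isMinimalPair_scale {u : F[X]} (hu : IsUnit u) {Q : F[X] × F[X]} (hQ : IsMinimalPair Q) :
    IsMinimalPair (scale u Q) := by
  intro D h4 h6
  exact hQ D ((hu.pow 4).dvd_mul_left.1 h4) ((hu.pow 6).dvd_mul_left.1 h6)

lemma shortCurve_injective : Function.Injective (shortCurve (F := F)) := by
  intro P Q h
  exact Prod.ext (congrArg WeierstrassCurve.a₄ h) (congrArg WeierstrassCurve.a₆ h)

lemma ratPair_injective : Function.Injective (ratPair (F := F)) := by
  intro P Q h
  exact Prod.ext (RatFunc.algebraMap_injective F (congrArg Prod.fst h))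
    (RatFunc.algebraMap_injective F (congrArg Prod.snd h))

lemma constChange_smul_eq_self_iff (a : Fˣ) (Q : F[X] × F[X]) :
    constChange a • shortCurve (ratPair Q) = shortCurve (ratPair Q) ↔
      (Q.1 = 0 ∨ a ^ 4 = 1) ∧ (Q.2 = 0 ∨ a ^ 6 = 1) := by
  have key : ∀ (n : ℕ) (A : F[X]), C (↑a⁻¹ : F) ^ n * A = A ↔ A = 0 ∨ a ^ n = 1 := by
    intro n A
    rw [← C_pow, ← Units.val_pow_eq_pow_val, inv_pow]
    by_cases hA : A = 0
    · simp [hA]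
    · rw [mul_eq_right₀ hA, ← C_1, C_inj, Units.val_eq_one, inv_eq_one]
      simp [hA]
  rw [constChange_smul, shortCurve_injective.eq_iff, ratPair_injective.eq_iff, Prod.ext_iff]
  exact and_congr (key 4 _) (key 6 _)

/-- The order of the automorphism group may be computed on any representative. -/
lemma autCard_mk (W : WeierstrassCurve (RatFunc F)) :
    autCard (Quotient.mk _ W : IsoClass F) =
      Nat.card (stabilizer (WeierstrassCurve.VariableChange (RatFunc F)) W) :=
  Nat.card_congr (stabilizerEquivStabilizerOfOrbitRel (Quotient.mk_out W)).toEquiv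

/-- Sets of at worst nodal curves that are stable under isomorphism. -/
structure IsInvariant (S : Set (WeierstrassCurve (RatFunc F))) : Prop where
  smul_mem : ∀ C : WeierstrassCurve.VariableChange (RatFunc F), ∀ W ∈ S, C • W ∈ S
  ne_zero : ∀ W ∈ S, W.Δ ≠ 0 ∨ W.c₄ ≠ 0

variable (F) in
/-- The globally minimal short equations. -/
def minimalCurves : Set (WeierstrassCurve (RatFunc F)) :=
  (fun Q => shortCurve (ratPair Q)) '' {Q | IsMinimalPair Q}

lemma ncard_inter_minimalCurves (S : Set (WeierstrassCurve (RatFunc F))) {T : Set (F[X] × F[X])}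
    (hT : ∀ Q, IsMinimalPair Q → (shortCurve (ratPair Q) ∈ S ↔ Q ∈ T)) :
    S ∩ minimalCurves F = (fun Q => shortCurve (ratPair Q)) '' (T ∩ {Q | IsMinimalPair Q}) ∧
    (S ∩ minimalCurves F).ncard = (T ∩ {Q | IsMinimalPair Q}).ncard := by
  have h : S ∩ minimalCurves F =
      (fun Q => shortCurve (ratPair Q)) '' (T ∩ {Q | IsMinimalPair Q}) := by
    ext W
    constructor
    · rintro ⟨hW, Q, hQ, rfl⟩
      exact ⟨Q, ⟨(hT Q hQ).1 hW, hQ⟩, rfl⟩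
    · rintro ⟨Q, ⟨hQT, hQ⟩, rfl⟩
      exact ⟨(hT Q hQ).2 hQT, Q, hQ, rfl⟩
  refine ⟨h, ?_⟩
  rw [h]
  exact Set.ncard_image_of_injective _ (shortCurve_injective.comp ratPair_injective)

lemma count_eq_mul_weightedCount {S : Set (WeierstrassCurve (RatFunc F))}
    (hfin : (isoClasses S).Finite) {n : ℕ} (hn : n ≠ 0)
    (h : ∀ c ∈ isoClasses S, autCard c = n) : (count S : ℝ) = n * weightedCount S := by
  rw [count, weightedCount, finsum_mem_congr rfl fun c hc => by rw [h c hc],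
    finsum_mem_eq_finite_toFinset_sum _ hfin, Finset.sum_const, Set.ncard_eq_toFinset_card _ hfin]
  rw [nsmul_eq_mul, mul_comm, mul_assoc, inv_mul_cancel₀ (by exact_mod_cast hn), mul_one]

/-- Both counts are additive. -/
lemma count_union {S T : Set (WeierstrassCurve (RatFunc F))} (hS : IsInvariant S)
    (hST : Disjoint S T) (hfS : (isoClasses S).Finite) (hfT : (isoClasses T).Finite) :
    count (S ∪ T) = count S + count T ∧
      weightedCount (S ∪ T) = weightedCount S + weightedCount T := by
  have hdisj : Disjoint (isoClasses S) (isoClasses T) := by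
    rw [Set.disjoint_left]
    rintro _ ⟨W, hW, rfl⟩ ⟨W', hW', h⟩
    obtain ⟨D, rfl⟩ := Quotient.exact h
    exact Set.disjoint_left.1 hST (hS.smul_mem _ _ hW) hW'
  have hunion : isoClasses (S ∪ T) = isoClasses S ∪ isoClasses T := Set.image_union _ _ _
  rw [count, weightedCount, hunion]
  exact ⟨Set.ncard_union_eq hdisj hfS hfT, finsum_mem_union hdisj hfS hfT⟩

variable (h2 : (2 : F) ≠ 0) (h3 : (3 : F) ≠ 0)

include h2 h3

/-- Writing u as a reduced fraction, Q scaled by the denominator equals Q' scaled by the numerator.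
The two are therefore associated, and u is constant. -/
lemma mem_range_constChange {Q Q' : F[X] × F[X]} (hQ : IsMinimalPair Q) (hQ' : IsMinimalPair Q')
    {D : WeierstrassCurve.VariableChange (RatFunc F)}
    (h : D • shortCurve (ratPair Q) = shortCurve (ratPair Q')) :
    D ∈ (constChange (F := F)).range := by
  have hD := eq_of_smul_shortCurve_eq h2 h3 h
  rw [hD, smul_shortCurve_of_unit] at h
  replace h := shortCurve_injective h
  set u : (RatFunc F)ˣ := D.u
  have hd : algebraMap F[X] (RatFunc F) (u : RatFunc F).denom ≠ 0 := by
    simpa using (u : RatFunc F).denom_ne_zero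
  have hu : (u : RatFunc F) = algebraMap F[X] (RatFunc F) (u : RatFunc F).num /
      algebraMap F[X] (RatFunc F) (u : RatFunc F).denom := (RatFunc.num_div_denom _).symm
  have hscale : scale (u : RatFunc F).denom Q = scale (u : RatFunc F).num Q' := by
    apply ratPair_injective
    have : ∀ (E : F[X]) (P : F[X] × F[X]),
        ratPair (scale E P) = scale (algebraMap F[X] (RatFunc F) E) (ratPair P) := by
      intro E P; simp [ratPair, scale]
    rw [this, this, ← h, scale_scale]
    congr 1
    rw [Units.val_inv_eq_inv_val, eq_mul_inv_iff_mul_eq₀ (Units.ne_zero u), mul_comm]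
    exact (eq_div_iff hd).1 hu
  obtain ⟨w, hw⟩ := associated_of_scale_eq hQ hQ' (RatFunc.denom_ne_zero _) hscale
  obtain ⟨c, hc, hcw⟩ := isUnit_iff.1 w.isUnit
  refine ⟨hc.unit, ?_⟩
  rw [hD]
  change (⟨_, 0, 0, 0⟩ : WeierstrassCurve.VariableChange (RatFunc F)) = _
  congr 1
  ext
  change algebraMap F (RatFunc F) c = u
  rw [hu, ← hw, ← hcw, map_mul, mul_div_cancel_left₀ _ hd]
  simp [RatFunc.algebraMap_eq_C]

lemma autCard_shortCurve {Q : F[X] × F[X]} (hQ : IsMinimalPair Q) :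
    autCard (Quotient.mk _ (shortCurve (ratPair Q)) : IsoClass F) =
      Nat.card {a : Fˣ // (Q.1 = 0 ∨ a ^ 4 = 1) ∧ (Q.2 = 0 ∨ a ^ 6 = 1)} := by
  rw [autCard_mk]
  refine (Nat.card_congr (Equiv.ofBijective (fun a : {a : Fˣ // _} =>
    (⟨constChange a.1, (constChange_smul_eq_self_iff _ _).2 a.2⟩ :
      stabilizer (WeierstrassCurve.VariableChange (RatFunc F)) (shortCurve (ratPair Q))))
    ⟨?_, ?_⟩)).symm
  · intro a b h
    exact Subtype.ext (constChange_injective (congrArg Subtype.val h))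
  · rintro ⟨D, hD⟩
    obtain ⟨a, rfl⟩ := mem_range_constChange h2 h3 hQ hQ hD
    exact ⟨⟨a, (constChange_smul_eq_self_iff _ _).1 hD⟩, rfl⟩

lemma IsInvariant.isoClasses_eq {S : Set (WeierstrassCurve (RatFunc F))} (hS : IsInvariant S) :
    isoClasses S = (fun W => (Quotient.mk _ W : IsoClass F)) '' (S ∩ minimalCurves F) := by
  apply Set.Subset.antisymm
  · rintro _ ⟨W, hW, rfl⟩
    obtain ⟨C, Q, hQ, hC⟩ := exists_smul_eq_minimal h2 h3 (hS.ne_zero W hW)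
    refine ⟨C • W, ⟨hS.smul_mem C W hW, Q, hQ, hC.symm⟩, ?_⟩
    exact Quotient.sound ⟨C, rfl⟩
  · exact Set.image_mono Set.inter_subset_left

/-- The minimal equations in a class form one orbit of Fˣ, and the stabilizer there is the whole
automorphism group; this is orbit-stabilizer for a group of order q - 1. -/
lemma IsInvariant.ncard_fiber_mul_autCard {S : Set (WeierstrassCurve (RatFunc F))}
    (hS : IsInvariant S) {c : IsoClass F} (hc : c ∈ isoClasses S) :
    {W ∈ S ∩ minimalCurves F | (Quotient.mk _ W : IsoClass F) = c}.ncard * autCard c =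
      Nat.card F - 1 := by
  rw [hS.isoClasses_eq h2 h3] at hc
  obtain ⟨_, ⟨hW, Q, hQ, rfl⟩, rfl⟩ := hc
  let H := (constChange (F := F)).range
  have hfiber : {W ∈ S ∩ minimalCurves F |
      (Quotient.mk _ W : IsoClass F) = Quotient.mk _ (shortCurve (ratPair Q))} =
      orbit H (shortCurve (ratPair Q)) := by
    ext W
    constructor
    · rintro ⟨⟨-, Q', hQ', rfl⟩, h⟩
      obtain ⟨D, hD⟩ := Quotient.exact h
      exact ⟨⟨D, mem_range_constChange h2 h3 hQ hQ' hD⟩, hD⟩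
    · rintro ⟨⟨_, a, rfl⟩, rfl⟩
      refine ⟨⟨hS.smul_mem _ _ hW, _, isMinimalPair_scale ?_ hQ, (constChange_smul a Q).symm⟩,
        Quotient.sound ⟨constChange a, rfl⟩⟩
      exact isUnit_C.2 (Units.isUnit _)
  have hstab : Nat.card (stabilizer H (shortCurve (ratPair Q))) =
      autCard (Quotient.mk _ (shortCurve (ratPair Q)) : IsoClass F) := by
    rw [autCard_mk]
    refine Nat.card_congr (Equiv.ofBijective (fun D => ⟨D.1.1, D.2⟩) ⟨?_, ?_⟩)
    · intro D E h
      exact Subtype.ext (Subtype.ext (congrArg (fun z : stabilizer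
        (WeierstrassCurve.VariableChange (RatFunc F)) (shortCurve (ratPair Q)) => z.1) h))
    · rintro ⟨D, hD⟩
      exact ⟨⟨⟨D, mem_range_constChange h2 h3 hQ hQ hD⟩, hD⟩, rfl⟩
  have hcard : Nat.card H = Nat.card F - 1 := by
    rw [← Nat.card_units]
    exact (Nat.card_congr (MonoidHom.ofInjective constChange_injective).toEquiv).symm
  rw [hfiber, ← hstab, ← hcard, ← Nat.card_congr (orbitProdStabilizerEquivGroup H (shortCurve (ratPair Q))), Nat.card_prod]
  rfl

variable [Finite F]

/-- Excludes an infinite group, for which `Nat.card` would be 0. -/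
lemma IsInvariant.autCard_ne_zero {S : Set (WeierstrassCurve (RatFunc F))}
    (hS : IsInvariant S) {c : IsoClass F} (hc : c ∈ isoClasses S) : autCard c ≠ 0 := by
  have h := hS.ncard_fiber_mul_autCard h2 h3 hc
  intro h0
  have := Finite.one_lt_card (α := F)
  rw [h0] at h
  omega

/-- The weight of a class is the number of its minimal equations divided by q - 1; summing over
classes counts all minimal equations. -/
lemma IsInvariant.weightedCount_eq {S : Set (WeierstrassCurve (RatFunc F))}
    (hS : IsInvariant S) (hfin : (S ∩ minimalCurves F).Finite) :
    (isoClasses S).Finite ∧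
      weightedCount S = ((S ∩ minimalCurves F).ncard : ℝ) / (Nat.card F - 1) := by
  classical
  have hiso := hS.isoClasses_eq h2 h3
  have hfin' : (isoClasses S).Finite := hiso ▸ hfin.image _
  refine ⟨hfin', ?_⟩
  have hmaps : (hfin.toFinset : Set (WeierstrassCurve (RatFunc F))).MapsTo
      (fun W => (Quotient.mk _ W : IsoClass F)) hfin'.toFinset := by
    intro W hW
    simp only [Set.Finite.coe_toFinset] at hW ⊢
    exact ⟨W, hW.1, rfl⟩
  have hq : (Nat.card F : ℝ) - 1 ≠ 0 := by
    have : (1 : ℝ) < Nat.card F := by exact_mod_cast Finite.one_lt_card (α := F)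
    linarith
  rw [weightedCount, finsum_mem_eq_finite_toFinset_sum _ hfin', Set.ncard_eq_toFinset_card _ hfin,
    Finset.card_eq_sum_card_fiberwise hmaps, Nat.cast_sum, Finset.sum_div]
  refine Finset.sum_congr rfl fun c hc => ?_
  have hc' : c ∈ isoClasses S := by simpa using hc
  have h := hS.ncard_fiber_mul_autCard h2 h3 hc'
  have h0 := hS.autCard_ne_zero h2 h3 hc'
  have hset : ({W ∈ hfin.toFinset | (Quotient.mk _ W : IsoClass F) = c}.card) =
      {W ∈ S ∩ minimalCurves F | (Quotient.mk _ W : IsoClass F) = c}.ncard := by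
    rw [← Set.ncard_coe_finset]
    congr 1
    ext W
    simp
  rw [hset]
  have h' : ({W ∈ S ∩ minimalCurves F | (Quotient.mk _ W : IsoClass F) = c}.ncard : ℝ) *
      autCard c = Nat.card F - 1 := by
    rw [← Nat.cast_mul, h, Nat.cast_sub Finite.one_lt_card.le, Nat.cast_one]
  rw [eq_div_iff hq, ← h']
  field_simp

end Classes

/-! ### Orders of the automorphism groups -/

section RootsOfUnity

variable [Finite F]

lemma card_units_pow_eq_one (n : ℕ) :
    Nat.card {a : Fˣ // a ^ n = 1} = (Nat.card F - 1).gcd n := by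
  rw [← Nat.card_units, ← IsCyclic.card_powMonoidHom_ker]
  rfl

lemma two_dvd_natCard_sub_one (h2 : (2 : F) ≠ 0) : 2 ∣ Nat.card F - 1 := by
  have : Fintype F := Fintype.ofFinite F
  have := FiniteField.odd_card_of_char_ne_two (F := F) (fun h => h2 (by
    have := ringChar.Nat.cast_ringChar (R := F)
    rw [h] at this
    exact_mod_cast this))
  rw [Nat.card_eq_fintype_card]
  omega

lemma card_units_sq_eq_one (h2 : (2 : F) ≠ 0) : Nat.card {a : Fˣ // a ^ 2 = 1} = 2 := by
  rw [card_units_pow_eq_one, Nat.gcd_eq_right (two_dvd_natCard_sub_one h2)]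

lemma card_units_pow_four_eq_one (h2 : (2 : F) ≠ 0) :
    (Nat.card {a : Fˣ // a ^ 4 = 1} : ℝ) = 2 + 2 * delta F 4 := by
  rw [card_units_pow_eq_one, delta]
  have h := two_dvd_natCard_sub_one h2
  split_ifs with h4
  · rw [Nat.gcd_eq_right h4]; norm_num
  · have h1 := Nat.gcd_dvd_left (Nat.card F - 1) 4
    have h1' := Nat.gcd_dvd_right (Nat.card F - 1) 4
    -- As q is odd, the gcd is even and divides 4; it is 2 unless 4 ∣ q - 1.
    have h1'' : 2 ∣ (Nat.card F - 1).gcd 4 := Nat.dvd_gcd h (by norm_num)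
    have hle := Nat.le_of_dvd (by norm_num) h1'
    generalize (Nat.card F - 1).gcd 4 = g at *
    have : g = 2 := by interval_cases g <;> omega
    rw [this]; norm_num

lemma card_units_pow_six_eq_one (h2 : (2 : F) ≠ 0) :
    (Nat.card {a : Fˣ // a ^ 6 = 1} : ℝ) = 2 + 4 * delta F 6 := by
  rw [card_units_pow_eq_one, delta]
  have h := two_dvd_natCard_sub_one h2
  split_ifs with h4
  · rw [Nat.gcd_eq_right h4]; norm_num
  · have h1 := Nat.gcd_dvd_left (Nat.card F - 1) 6
    have h1' := Nat.gcd_dvd_right (Nat.card F - 1) 6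
    have h1'' : 2 ∣ (Nat.card F - 1).gcd 6 := Nat.dvd_gcd h (by norm_num)
    have hle := Nat.le_of_dvd (by norm_num) h1'
    generalize (Nat.card F - 1).gcd 6 = g at *
    have : g = 2 := by interval_cases g <;> omega
    rw [this]; norm_num

lemma card_aut_generic (h2 : (2 : F) ≠ 0) {Q : F[X] × F[X]} (hA : Q.1 ≠ 0) (hB : Q.2 ≠ 0) :
    Nat.card {a : Fˣ // (Q.1 = 0 ∨ a ^ 4 = 1) ∧ (Q.2 = 0 ∨ a ^ 6 = 1)} = 2 := by
  rw [← card_units_sq_eq_one h2]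
  refine Nat.card_congr (Equiv.subtypeEquivRight fun a => ?_)
  simp only [hA, hB, false_or]
  constructor
  · rintro ⟨h4, h6⟩
    rw [← h6, pow_add a 4 2, h4, one_mul]
  · intro h
    rw [pow_mul a 2 2, pow_mul a 2 3, h]
    simp

end RootsOfUnity

/-! ### Counts of the families of bounded height -/

section Families

open Polynomial

/-- The at worst nodal curves of height at most `N` with a given property. -/
def boundedCurves (N : ℕ) (Z : WeierstrassCurve (RatFunc F) → Prop) :
    Set (WeierstrassCurve (RatFunc F)) :=
  {W | (W.Δ ≠ 0 ∨ W.c₄ ≠ 0) ∧ Z W ∧ faltingsHeight W ≤ N}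

lemma smul_invariants_eq_zero_iff (C : WeierstrassCurve.VariableChange (RatFunc F))
    (W : WeierstrassCurve (RatFunc F)) :
    ((C • W).Δ = 0 ↔ W.Δ = 0) ∧ ((C • W).c₄ = 0 ↔ W.c₄ = 0) ∧ ((C • W).c₆ = 0 ↔ W.c₆ = 0) := by
  rw [WeierstrassCurve.variableChange_Δ, WeierstrassCurve.variableChange_c₄,
    WeierstrassCurve.variableChange_c₆]
  simp

/-- Heights are integers, so B matters only through the largest q^(12m) below it. -/
lemma zpow_height_le_iff {q B : ℝ} (hq : 1 < q) {m : ℕ} (hle : q ^ (12 * m) ≤ B)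
    (hlt : B < q ^ (12 * (m + 1))) (h : ℤ) : q ^ (12 * h) ≤ B ↔ h ≤ m := by
  constructor
  · intro hB
    by_contra! hm
    have : q ^ (12 * (m + 1)) ≤ q ^ (12 * h) := by
      rw [← zpow_natCast]
      exact zpow_le_zpow_right₀ hq.le (by push_cast; omega)
    linarith
  · intro hm
    refine le_trans ?_ hle
    rw [← zpow_natCast]
    exact zpow_le_zpow_right₀ hq.le (by push_cast; omega)

lemma scale_disc (D : F[X]) (P : F[X] × F[X]) :
    4 * (scale D P).1 ^ 3 + 27 * (scale D P).2 ^ 2 = D ^ 12 * (4 * P.1 ^ 3 + 27 * P.2 ^ 2) := by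
  simp only [scale]; ring

lemma nodal_smul (C : WeierstrassCurve.VariableChange (RatFunc F))
    (W : WeierstrassCurve (RatFunc F)) (h : W.Δ = 0) : (C • W).Δ = 0 :=
  (smul_invariants_eq_zero_iff C W).1.2 h

lemma elliptic_smul (C : WeierstrassCurve.VariableChange (RatFunc F))
    (W : WeierstrassCurve (RatFunc F)) (h : W.Δ ≠ 0) : (C • W).Δ ≠ 0 :=
  (smul_invariants_eq_zero_iff C W).1.not.2 h

lemma c₄_eq_zero_smul (C : WeierstrassCurve.VariableChange (RatFunc F))
    (W : WeierstrassCurve (RatFunc F)) (h : W.Δ ≠ 0 ∧ W.c₄ = 0) :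
    (C • W).Δ ≠ 0 ∧ (C • W).c₄ = 0 :=
  ⟨elliptic_smul C W h.1, (smul_invariants_eq_zero_iff C W).2.1.2 h.2⟩

lemma c₆_eq_zero_smul (C : WeierstrassCurve.VariableChange (RatFunc F))
    (W : WeierstrassCurve (RatFunc F)) (h : W.Δ ≠ 0 ∧ W.c₆ = 0) :
    (C • W).Δ ≠ 0 ∧ (C • W).c₆ = 0 :=
  ⟨elliptic_smul C W h.1, (smul_invariants_eq_zero_iff C W).2.2.2 h.2⟩

lemma generic_smul (C : WeierstrassCurve.VariableChange (RatFunc F))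
    (W : WeierstrassCurve (RatFunc F)) (h : W.Δ ≠ 0 ∧ W.c₄ ≠ 0 ∧ W.c₆ ≠ 0) :
    (C • W).Δ ≠ 0 ∧ (C • W).c₄ ≠ 0 ∧ (C • W).c₆ ≠ 0 :=
  ⟨elliptic_smul C W h.1, (smul_invariants_eq_zero_iff C W).2.1.not.2 h.2.1,
    (smul_invariants_eq_zero_iff C W).2.2.not.2 h.2.2⟩

variable (h2 : (2 : F) ≠ 0) (h3 : (3 : F) ≠ 0)

include h2 h3

lemma faltingsHeight_smul {W : WeierstrassCurve (RatFunc F)} (hW : W.Δ ≠ 0 ∨ W.c₄ ≠ 0)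
    (C : WeierstrassCurve.VariableChange (RatFunc F)) :
    faltingsHeight (C • W) = faltingsHeight W := by
  obtain ⟨D, Q, hQ, hD⟩ := exists_smul_eq_minimal h2 h3 hW
  rw [(finite_support_and_finsum_minimizingOrd h2 h3 hQ hD).2,
    (finite_support_and_finsum_minimizingOrd h2 h3 (C := D * C⁻¹) hQ (by
      rw [← mul_smul, inv_mul_cancel_right, hD])).2]

lemma isInvariant_boundedCurves (N : ℕ) {Z : WeierstrassCurve (RatFunc F) → Prop}
    (hZ : ∀ (C : WeierstrassCurve.VariableChange (RatFunc F)) W, Z W → Z (C • W)) :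
    IsInvariant (boundedCurves N Z) where
  smul_mem C W hW := by
    obtain ⟨hΔ, h4, -⟩ := smul_invariants_eq_zero_iff C W
    refine ⟨?_, hZ C W hW.2.1, ?_⟩
    · rw [ne_eq, ne_eq, hΔ, h4]; exact hW.1
    · rw [faltingsHeight_smul h2 h3 hW.1]; exact hW.2.2
  ne_zero W hW := hW.1

lemma invariants_shortCurve_eq_zero_iff (Q : F[X] × F[X]) :
    ((shortCurve (ratPair Q)).Δ = 0 ↔ 4 * Q.1 ^ 3 + 27 * Q.2 ^ 2 = 0) ∧
      ((shortCurve (ratPair Q)).c₄ = 0 ↔ Q.1 = 0) ∧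
      ((shortCurve (ratPair Q)).c₆ = 0 ↔ Q.2 = 0) := by
  have h2' : (2 : RatFunc F) ≠ 0 := natCast_ne_zero_ratFunc (n := 2) h2
  have h3' : (3 : RatFunc F) ≠ 0 := natCast_ne_zero_ratFunc (n := 3) h3
  have h16 : (-16 : RatFunc F) ≠ 0 := by
    rw [show (-16 : RatFunc F) = -2 ^ 4 by norm_num]; simp [h2']
  have h48 : (-48 : RatFunc F) ≠ 0 := by
    rw [show (-48 : RatFunc F) = -(2 ^ 4 * 3) by norm_num]; simp [h2', h3']
  have h864 : (-864 : RatFunc F) ≠ 0 := by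
    rw [show (-864 : RatFunc F) = -(2 ^ 5 * 3 ^ 3) by norm_num]; simp [h2', h3']
  have hinj := (injective_iff_map_eq_zero' _).1 (RatFunc.algebraMap_injective F)
  rw [WeierstrassCurve.Δ_of_isShortNF, WeierstrassCurve.c₄_of_isShortNF,
    WeierstrassCurve.c₆_of_isShortNF, mul_eq_zero_iff_left h16, mul_eq_zero_iff_left h48,
    mul_eq_zero_iff_left h864, ← hinj (4 * Q.1 ^ 3 + 27 * Q.2 ^ 2), ← hinj Q.1, ← hinj Q.2]
  refine ⟨?_, Iff.rfl, Iff.rfl⟩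
  simp only [map_add, map_mul, map_pow, map_ofNat]
  rfl

lemma shortCurve_mem_boundedCurves {N : ℕ} {Z : WeierstrassCurve (RatFunc F) → Prop}
    {Q : F[X] × F[X]} (hQ : IsMinimalPair Q) :
    shortCurve (ratPair Q) ∈ boundedCurves N Z ↔
      Z (shortCurve (ratPair Q)) ∧ Q ∈ degreeBox F N := by
  obtain ⟨hΔ, h4, h6⟩ := invariants_shortCurve_eq_zero_iff h2 h3 Q
  have hne : (shortCurve (ratPair Q)).Δ ≠ 0 ∨ (shortCurve (ratPair Q)).c₄ ≠ 0 := by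
    rw [ne_eq, ne_eq, hΔ, h4, ← not_and_or]
    rintro ⟨h, hA⟩
    have h27 : (27 : F[X]) ≠ 0 := by
      rw [show (27 : F[X]) = C (3 ^ 3) by rw [C_pow]; change (27 : F[X]) = 3 ^ 3; norm_num]
      simpa using h3
    rw [hA] at h
    exact hQ.ne_zero (Prod.ext hA (by simpa [h27] using h))
  have hh := (faltingsHeight_nonneg_and_le_iff h2 h3 (C := 1) hQ (one_smul _ _)).2 N
  simp only [boundedCurves, Set.mem_ofPred_eq, hh]
  tauto

/-- By 1728Δ = c₄³ - c₆², a singular equation with one of c₄, c₆ zero has both zero, which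
minimality forbids. So nodal curves have a, b ≠ 0 and only the automorphisms ±1. -/
lemma disc_ne_zero_of {Q : F[X] × F[X]} (hQ : IsMinimalPair Q) (h : Q.1 = 0 ∨ Q.2 = 0) :
    (shortCurve (ratPair Q)).Δ ≠ 0 := by
  obtain ⟨-, h4, h6⟩ := invariants_shortCurve_eq_zero_iff h2 h3 Q
  intro hΔ
  have hrel := (shortCurve (ratPair Q)).c_relation
  rw [hΔ, mul_zero] at hrel
  rcases h with h | h
  · rw [h4.2 h, zero_pow three_ne_zero, zero_sub, eq_comm, neg_eq_zero,
      pow_eq_zero_iff two_ne_zero] at hrel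
    exact hQ.ne_zero (Prod.ext h (h6.1 hrel))
  · rw [h6.2 h, zero_pow two_ne_zero, sub_zero, eq_comm, pow_eq_zero_iff three_ne_zero] at hrel
    exact hQ.ne_zero (Prod.ext (h4.1 hrel) h)

variable [Finite F]

lemma finite_isoClasses_boundedCurves (N : ℕ) {Z : WeierstrassCurve (RatFunc F) → Prop}
    (hZ : ∀ (C : WeierstrassCurve.VariableChange (RatFunc F)) W, Z W → Z (C • W)) :
    (isoClasses (boundedCurves N Z)).Finite := by
  refine ((isInvariant_boundedCurves h2 h3 N hZ).weightedCount_eq h2 h3 ?_).1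
  refine ((finite_degreeBox (F := F) N).image fun Q => shortCurve (ratPair Q)).subset ?_
  rintro _ ⟨hW, Q, hQ, rfl⟩
  exact ⟨Q, ((shortCurve_mem_boundedCurves h2 h3 hQ).1 hW).2, rfl⟩

/-- The bound is N + 1 because the recurrence needs a smaller box: in the box 0 every nonzero pair
is already minimal, and there are q^l - 1 of them. -/
lemma weightedCount_boundedCurves {N : ℕ} {Z : WeierstrassCurve (RatFunc F) → Prop}
    (hZ : ∀ (C : WeierstrassCurve.VariableChange (RatFunc F)) W, Z W → Z (C • W))
    {T : F[X] × F[X] → Prop}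
    (hZT : ∀ Q, IsMinimalPair Q → (Z (shortCurve (ratPair Q)) ↔ T Q))
    (hT : ∀ D : F[X], D ≠ 0 → ∀ P, T (scale D P) ↔ T P) (k l : ℕ)
    (h : ∀ N, ({P | P ≠ 0 ∧ T P} ∩ degreeBox F N).ncard + 1 = Nat.card F ^ (k * N + l)) :
    weightedCount (boundedCurves (N + 1) Z) =
      ((Nat.card F : ℝ) ^ (k * (N + 1) + l) - (Nat.card F : ℝ) ^ (k * N + l + 1)) /
        (Nat.card F - 1) + 1 := by
  have hq : (Nat.card F : ℝ) - 1 ≠ 0 := by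
    have : (1 : ℝ) < Nat.card F := by exact_mod_cast Finite.one_lt_card (α := F)
    linarith
  obtain ⟨himage, hcard⟩ := ncard_inter_minimalCurves (boundedCurves (N + 1) Z)
    (T := {P | P ≠ 0 ∧ T P} ∩ degreeBox F (N + 1)) (fun Q hQ => by
      rw [shortCurve_mem_boundedCurves h2 h3 hQ, hZT Q hQ]
      have := hQ.ne_zero
      exact and_congr_left fun _ => ⟨fun h => ⟨this, h⟩, fun h => h.2⟩)
  have hfin : (boundedCurves (N + 1) Z ∩ minimalCurves F).Finite := by
    rw [himage]
    exact ((finite_degreeBox (N + 1)).subset fun _ h => h.1.2).image _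
  rw [((isInvariant_boundedCurves h2 h3 (N + 1) hZ).weightedCount_eq h2 h3 hfin).2, hcard,
    ncard_minimal_of_ncard (by simp) (fun D hD P => ?_) k l h]
  · field_simp
  · exact and_congr (not_congr (scale_eq_zero hD)) (hT D hD P)

lemma count_boundedCurves {N : ℕ} {Z : WeierstrassCurve (RatFunc F) → Prop}
    (hZ : ∀ (C : WeierstrassCurve.VariableChange (RatFunc F)) W, Z W → Z (C • W)) {n : ℕ}
    (hn : n ≠ 0) (h : ∀ Q, IsMinimalPair Q → Z (shortCurve (ratPair Q)) →
      Nat.card {a : Fˣ // (Q.1 = 0 ∨ a ^ 4 = 1) ∧ (Q.2 = 0 ∨ a ^ 6 = 1)} = n) :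
    (count (boundedCurves N Z) : ℝ) = n * weightedCount (boundedCurves N Z) := by
  refine count_eq_mul_weightedCount (finite_isoClasses_boundedCurves h2 h3 N hZ) hn fun c hc => ?_
  rw [(isInvariant_boundedCurves h2 h3 N hZ).isoClasses_eq h2 h3] at hc
  obtain ⟨_, ⟨hW, Q, hQ, rfl⟩, rfl⟩ := hc
  rw [autCard_shortCurve h2 h3 hQ]
  exact h Q hQ hW.2.1

/-! ### The individual families -/

lemma weightedCount_stable (N : ℕ) :
    weightedCount (boundedCurves (F := F) (N + 1) fun _ => True) =
      ((Nat.card F : ℝ) ^ (10 * (N + 1) + 2) - (Nat.card F : ℝ) ^ (10 * N + 2 + 1)) /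
        (Nat.card F - 1) + 1 :=
  weightedCount_boundedCurves h2 h3 (fun _ _ h => h) (T := fun _ => True) (fun _ _ => Iff.rfl)
    (fun _ _ _ => Iff.rfl) 10 2 (by simpa using ncard_ne_zero_inter_degreeBox)

lemma weightedCount_nodal (N : ℕ) :
    weightedCount (boundedCurves (F := F) (N + 1) fun W => W.Δ = 0) =
      ((Nat.card F : ℝ) ^ (2 * (N + 1) + 1) - (Nat.card F : ℝ) ^ (2 * N + 1 + 1)) /
        (Nat.card F - 1) + 1 :=
  weightedCount_boundedCurves h2 h3 nodal_smul (T := fun P => 4 * P.1 ^ 3 + 27 * P.2 ^ 2 = 0)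
    (fun Q _ => (invariants_shortCurve_eq_zero_iff h2 h3 Q).1)
    (fun D hD P => by rw [scale_disc, mul_eq_zero_iff_left (pow_ne_zero 12 hD)]) 2 1
    (ncard_disc_eq_zero_inter_degreeBox h2 h3)

lemma weightedCount_c₄_eq_zero (N : ℕ) :
    weightedCount (boundedCurves (F := F) (N + 1) fun W => W.Δ ≠ 0 ∧ W.c₄ = 0) =
      ((Nat.card F : ℝ) ^ (6 * (N + 1) + 1) - (Nat.card F : ℝ) ^ (6 * N + 1 + 1)) /
        (Nat.card F - 1) + 1 :=
  weightedCount_boundedCurves h2 h3 c₄_eq_zero_smul (T := fun P => P.1 = 0)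
    (fun Q hQ => by
      rw [(invariants_shortCurve_eq_zero_iff h2 h3 Q).2.1]
      exact ⟨fun h => h.2, fun h => ⟨disc_ne_zero_of h2 h3 hQ (Or.inl h), h⟩⟩)
    (fun D hD P => by simp [scale, hD]) 6 1 ncard_fst_eq_zero_inter_degreeBox

lemma weightedCount_c₆_eq_zero (N : ℕ) :
    weightedCount (boundedCurves (F := F) (N + 1) fun W => W.Δ ≠ 0 ∧ W.c₆ = 0) =
      ((Nat.card F : ℝ) ^ (4 * (N + 1) + 1) - (Nat.card F : ℝ) ^ (4 * N + 1 + 1)) /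
        (Nat.card F - 1) + 1 :=
  weightedCount_boundedCurves h2 h3 c₆_eq_zero_smul (T := fun P => P.2 = 0)
    (fun Q hQ => by
      rw [(invariants_shortCurve_eq_zero_iff h2 h3 Q).2.2]
      exact ⟨fun h => h.2, fun h => ⟨disc_ne_zero_of h2 h3 hQ (Or.inr h), h⟩⟩)
    (fun D hD P => by simp [scale, hD]) 4 1 ncard_snd_eq_zero_inter_degreeBox

lemma count_nodal (N : ℕ) :
    (count (boundedCurves (F := F) N fun W => W.Δ = 0) : ℝ) =
      2 * weightedCount (boundedCurves (F := F) N fun W => W.Δ = 0) :=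
  count_boundedCurves h2 h3 nodal_smul two_ne_zero fun _ hQ h =>
    card_aut_generic h2 (fun hA => disc_ne_zero_of h2 h3 hQ (Or.inl hA) h)
      (fun hB => disc_ne_zero_of h2 h3 hQ (Or.inr hB) h)

lemma count_generic (N : ℕ) :
    (count (boundedCurves (F := F) N fun W => W.Δ ≠ 0 ∧ W.c₄ ≠ 0 ∧ W.c₆ ≠ 0) : ℝ) =
      2 * weightedCount (boundedCurves (F := F) N fun W => W.Δ ≠ 0 ∧ W.c₄ ≠ 0 ∧ W.c₆ ≠ 0) :=
  count_boundedCurves h2 h3 generic_smul two_ne_zero fun Q _ h => by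
    obtain ⟨-, h4, h6⟩ := invariants_shortCurve_eq_zero_iff h2 h3 Q
    exact card_aut_generic h2 (h4.not.1 h.2.1) (h6.not.1 h.2.2)

lemma count_c₄_eq_zero (N : ℕ) :
    (count (boundedCurves (F := F) N fun W => W.Δ ≠ 0 ∧ W.c₄ = 0) : ℝ) =
      (2 + 4 * delta F 6) *
        weightedCount (boundedCurves (F := F) N fun W => W.Δ ≠ 0 ∧ W.c₄ = 0) := by
  rw [← card_units_pow_six_eq_one h2]
  have : Nonempty {a : Fˣ // a ^ 6 = 1} := ⟨1, one_pow 6⟩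
  refine count_boundedCurves h2 h3 c₄_eq_zero_smul Nat.card_pos.ne' fun Q hQ h => ?_
  obtain ⟨-, h4, -⟩ := invariants_shortCurve_eq_zero_iff h2 h3 Q
  have hA := h4.1 h.2
  have hB : Q.2 ≠ 0 := fun hB => hQ.ne_zero (Prod.ext hA hB)
  simp [hA, hB]

lemma count_c₆_eq_zero (N : ℕ) :
    (count (boundedCurves (F := F) N fun W => W.Δ ≠ 0 ∧ W.c₆ = 0) : ℝ) =
      (2 + 2 * delta F 4) *
        weightedCount (boundedCurves (F := F) N fun W => W.Δ ≠ 0 ∧ W.c₆ = 0) := by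
  rw [← card_units_pow_four_eq_one h2]
  have : Nonempty {a : Fˣ // a ^ 4 = 1} := ⟨1, one_pow 4⟩
  refine count_boundedCurves h2 h3 c₆_eq_zero_smul Nat.card_pos.ne' fun Q hQ h => ?_
  obtain ⟨-, -, h6⟩ := invariants_shortCurve_eq_zero_iff h2 h3 Q
  have hB := h6.1 h.2
  have hA : Q.1 ≠ 0 := fun hA => hQ.ne_zero (Prod.ext hA hB)
  simp [hA, hB]

lemma count_stable_eq (N : ℕ) :
    count (boundedCurves (F := F) N fun _ => True) =
      count (boundedCurves (F := F) N fun W => W.Δ ≠ 0) +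
        count (boundedCurves (F := F) N fun W => W.Δ = 0) ∧
    weightedCount (boundedCurves (F := F) N fun _ => True) =
      weightedCount (boundedCurves (F := F) N fun W => W.Δ ≠ 0) +
        weightedCount (boundedCurves (F := F) N fun W => W.Δ = 0) := by
  have h : (boundedCurves (F := F) N fun _ => True) =
      (boundedCurves N fun W => W.Δ ≠ 0) ∪ boundedCurves N fun W => W.Δ = 0 := by
    ext W
    simp only [boundedCurves, Set.mem_union, Set.mem_ofPred_eq]
    tauto
  rw [h]
  exact count_union (isInvariant_boundedCurves h2 h3 N elliptic_smul)
    (Set.disjoint_left.2 fun W h h' => h.2.1 h'.2.1)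
    (finite_isoClasses_boundedCurves h2 h3 N elliptic_smul)
    (finite_isoClasses_boundedCurves h2 h3 N nodal_smul)

/-- The loci c₄ = 0 and c₆ = 0 are disjoint on smooth curves because c₄ = c₆ = 0 forces 1728Δ = 0.
-/
lemma count_elliptic_eq (N : ℕ) :
    count (boundedCurves (F := F) N fun W => W.Δ ≠ 0) =
      count (boundedCurves (F := F) N fun W => W.Δ ≠ 0 ∧ W.c₄ ≠ 0 ∧ W.c₆ ≠ 0) +
        count (boundedCurves (F := F) N fun W => W.Δ ≠ 0 ∧ W.c₄ = 0) +
        count (boundedCurves (F := F) N fun W => W.Δ ≠ 0 ∧ W.c₆ = 0) ∧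
    weightedCount (boundedCurves (F := F) N fun W => W.Δ ≠ 0) =
      weightedCount (boundedCurves (F := F) N fun W => W.Δ ≠ 0 ∧ W.c₄ ≠ 0 ∧ W.c₆ ≠ 0) +
        weightedCount (boundedCurves (F := F) N fun W => W.Δ ≠ 0 ∧ W.c₄ = 0) +
        weightedCount (boundedCurves (F := F) N fun W => W.Δ ≠ 0 ∧ W.c₆ = 0) := by
  have hc : ∀ W : WeierstrassCurve (RatFunc F), W.c₄ = 0 → W.c₆ = 0 → W.Δ = 0 := by
    intro W h4 h6
    have hrel := W.c_relation
    have h1728 : (1728 : RatFunc F) ≠ 0 := by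
      rw [show (1728 : RatFunc F) = (2 : ℕ) ^ 6 * (3 : ℕ) ^ 3 by norm_num]
      exact mul_ne_zero (pow_ne_zero _ (natCast_ne_zero_ratFunc h2))
        (pow_ne_zero _ (natCast_ne_zero_ratFunc h3))
    rw [h4, h6] at hrel
    simpa [h1728] using hrel
  have h : (boundedCurves (F := F) N fun W => W.Δ ≠ 0) =
      (boundedCurves N fun W => W.Δ ≠ 0 ∧ W.c₄ ≠ 0 ∧ W.c₆ ≠ 0) ∪
        ((boundedCurves N fun W => W.Δ ≠ 0 ∧ W.c₄ = 0) ∪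
        boundedCurves N fun W => W.Δ ≠ 0 ∧ W.c₆ = 0) := by
    ext W
    simp only [boundedCurves, Set.mem_union, Set.mem_ofPred_eq]
    tauto
  have hf0 := finite_isoClasses_boundedCurves h2 h3 N generic_smul
  have hf4 := finite_isoClasses_boundedCurves h2 h3 N c₄_eq_zero_smul
  have hf6 := finite_isoClasses_boundedCurves h2 h3 N c₆_eq_zero_smul
  have h46 := count_union (isInvariant_boundedCurves h2 h3 N c₄_eq_zero_smul)
    (Set.disjoint_left.2 fun W h h' => h.2.1.1 (hc W h.2.1.2 h'.2.1.2)) hf4 hf6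
  have hdisj : Disjoint (boundedCurves (F := F) N fun W => W.Δ ≠ 0 ∧ W.c₄ ≠ 0 ∧ W.c₆ ≠ 0)
      ((boundedCurves N fun W => W.Δ ≠ 0 ∧ W.c₄ = 0) ∪
        boundedCurves N fun W => W.Δ ≠ 0 ∧ W.c₆ = 0) :=
    Set.disjoint_union_right.2 ⟨Set.disjoint_left.2 fun W h h' => h.2.1.2.1 h'.2.1.2,
      Set.disjoint_left.2 fun W h h' => h.2.1.2.2 h'.2.1.2⟩
  have h046 := count_union (isInvariant_boundedCurves h2 h3 N generic_smul)
    hdisj hf0 (by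
        rw [isoClasses, Set.image_union]; exact hf4.union hf6)
  rw [h, h046.1, h046.2, h46.1, h46.2, add_assoc, add_assoc]
  exact ⟨rfl, rfl⟩

end Families

/-! ### The height conditions in terms of the bound m -/

section Identification

variable {q B : ℝ} (hq : q = (Nat.card F : ℝ)) {m : ℕ} (hle : q ^ (12 * m) ≤ B)
  (hlt : B < q ^ (12 * (m + 1)))

include hq hle hlt

lemma stableCurves_eq [Finite F] : stableCurves F B = boundedCurves m fun _ => True := by
  have hq1 : 1 < q := by rw [hq]; exact_mod_cast Finite.one_lt_card (α := F)
  ext W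
  simp only [stableCurves, boundedCurves, Set.mem_ofPred_eq, ← hq, true_and,
    zpow_height_le_iff hq1 hle hlt]

lemma nodalCurves_eq [Finite F] : nodalCurves F B = boundedCurves m fun W => W.Δ = 0 := by
  have hq1 : 1 < q := by rw [hq]; exact_mod_cast Finite.one_lt_card (α := F)
  ext W
  simp only [nodalCurves, boundedCurves, Set.mem_ofPred_eq, ← hq,
    zpow_height_le_iff hq1 hle hlt]
  tauto

variable (h2 : (2 : F) ≠ 0) (h3 : (3 : F) ≠ 0)

include h2 h3

lemma ellipticCurves_eq [Finite F] : ellipticCurves F B = boundedCurves m fun W => W.Δ ≠ 0 := by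
  have hq1 : 1 < q := by rw [hq]; exact_mod_cast Finite.one_lt_card (α := F)
  ext W
  have hiff : W.Δ ≠ 0 → (q ^ minDiscDegree W ≤ B ↔ faltingsHeight W ≤ m) := by
    intro hΔ
    rw [← zpow_height_le_iff hq1 hle hlt, ← minDiscDegree_eq h2 h3 hΔ, zpow_natCast]
  simp only [ellipticCurves, boundedCurves, Set.mem_ofPred_eq, ← hq,
    WeierstrassCurve.isElliptic_iff, isUnit_iff_ne_zero]
  tauto

lemma ellipticCurvesWithJ_zero_eq [Finite F] :
    ellipticCurvesWithJ F 0 B = boundedCurves m fun W => W.Δ ≠ 0 ∧ W.c₄ = 0 := by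
  ext W
  rw [ellipticCurvesWithJ, ellipticCurves_eq hq hle hlt h2 h3]
  constructor
  · rintro ⟨h, hW, hj⟩
    exact ⟨h.1, ⟨h.2.1, W.j_eq_zero_iff.1 hj⟩, h.2.2⟩
  · rintro ⟨h, ⟨hΔ, h4⟩, hh⟩
    exact ⟨⟨h, hΔ, hh⟩, ⟨isUnit_iff_ne_zero.2 hΔ⟩,
      let : W.IsElliptic := ⟨isUnit_iff_ne_zero.2 hΔ⟩; W.j_eq_zero h4⟩

lemma ellipticCurvesWithJ_1728_eq [Finite F] :
    ellipticCurvesWithJ F 1728 B = boundedCurves m fun W => W.Δ ≠ 0 ∧ W.c₆ = 0 := by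
  -- This is j - 1728 = c₆²/Δ.
  have hj : ∀ (W : WeierstrassCurve (RatFunc F)) [W.IsElliptic], W.j = 1728 ↔ W.c₆ = 0 := by
    intro W _
    have hΔ : W.Δ ≠ 0 := W.isUnit_Δ.ne_zero
    rw [WeierstrassCurve.j, Units.val_inv_eq_inv_val, WeierstrassCurve.coe_Δ',
      inv_mul_eq_iff_eq_mul₀ hΔ, mul_comm, W.c_relation, eq_comm, sub_eq_self]
    simp
  ext W
  rw [ellipticCurvesWithJ, ellipticCurves_eq hq hle hlt h2 h3]
  constructor
  · rintro ⟨h, hW, h'⟩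
    exact ⟨h.1, ⟨h.2.1, (hj W).1 h'⟩, h.2.2⟩
  · rintro ⟨h, ⟨hΔ, h6⟩, hh⟩
    exact ⟨⟨h, hΔ, hh⟩, ⟨isUnit_iff_ne_zero.2 hΔ⟩,
      let : W.IsElliptic := ⟨isUnit_iff_ne_zero.2 hΔ⟩; (hj W).2 h6⟩

end Identification

lemma rpow_eq_pow_of_mul_eq {q : ℝ} (hq : 0 ≤ q) {m k : ℕ} {r : ℝ} (h : 12 * r = k) :
    (q ^ (12 * m)) ^ r = q ^ (k * m) := by
  rw [← Real.rpow_natCast, ← Real.rpow_mul hq, ← Real.rpow_natCast]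
  congr 1
  push_cast
  rw [← h]
  ring

lemma natCast_ne_zero_of_lt_ringChar {n : ℕ} (h0 : n ≠ 0) (hn : n < ringChar F) :
    (n : F) ≠ 0 := fun h =>
  absurd (Nat.le_of_dvd (Nat.pos_of_ne_zero h0) (ringChar.dvd h)) (not_le.2 hn)

end EllCount

end

/-- `F` is the field with `q` elements and `B₀ = q ^ (12 m)` is the largest attained height of a
discriminant that is at most `B`; in particular `B = B₀` is allowed. -/
theorem theorem1p1 {F : Type*} [Field F] [Finite F] (hchar : 3 < ringChar F)
    (q : ℝ) (hq : q = (Nat.card F : ℝ)) (m : ℕ) (hm : 1 ≤ m)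
    (B₀ B : ℝ) (hB₀ : B₀ = q ^ (12 * m)) (hle : B₀ ≤ B) (hlt : B < q ^ (12 * (m + 1))) :
    -- the minimal discriminant has degree `12 n`, where `n ≥ 0` is the height
    (∀ W : WeierstrassCurve (RatFunc F), W.IsElliptic →
      0 ≤ EllCount.faltingsHeight W ∧
        (EllCount.minDiscDegree W : ℤ) = 12 * EllCount.faltingsHeight W) ∧
    -- all the sets that are counted are finite
    (EllCount.isoClasses (EllCount.ellipticCurves F B)).Finite ∧
    (EllCount.isoClasses (EllCount.stableCurves F B)).Finite ∧
    -- the weighted count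
    EllCount.weightedCount (EllCount.ellipticCurves F B) =
      (q ^ 9 - 1) / (q ^ 8 - q ^ 7) * B₀ ^ (5 / 6 : ℝ) - B₀ ^ (1 / 6 : ℝ) ∧
    -- the unweighted count
    (EllCount.count (EllCount.ellipticCurves F B) : ℝ) =
      2 * ((q ^ 9 - 1) / (q ^ 8 - q ^ 7)) * B₀ ^ (5 / 6 : ℝ)
        + EllCount.delta F 6 * 4 * ((q ^ 5 - 1) / (q ^ 5 - q ^ 4)) * B₀ ^ (1 / 2 : ℝ)
        + EllCount.delta F 4 * 2 * ((q ^ 3 - 1) / (q ^ 3 - q ^ 2)) * B₀ ^ (1 / 3 : ℝ)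
        - 2 * B₀ ^ (1 / 6 : ℝ)
        + EllCount.delta F 6 * 4 + EllCount.delta F 4 * 2 ∧
    -- the term in `B ^ (1/6)` is the removal of the `μ₂`-twist family at `j = ∞`
    EllCount.weightedCount (EllCount.ellipticCurves F B) =
      EllCount.weightedCount (EllCount.stableCurves F B)
        - EllCount.weightedCount (EllCount.nodalCurves F B) ∧
    EllCount.weightedCount (EllCount.stableCurves F B) =
      (q ^ 9 - 1) / (q ^ 8 - q ^ 7) * B₀ ^ (5 / 6 : ℝ) + 1 ∧
    EllCount.weightedCount (EllCount.nodalCurves F B) = B₀ ^ (1 / 6 : ℝ) + 1 ∧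
    (EllCount.count (EllCount.ellipticCurves F B) : ℝ) =
      (EllCount.count (EllCount.stableCurves F B) : ℝ)
        - (EllCount.count (EllCount.nodalCurves F B) : ℝ) ∧
    (EllCount.count (EllCount.nodalCurves F B) : ℝ) = 2 * B₀ ^ (1 / 6 : ℝ) + 2 ∧
    -- the terms in `B ^ (1/2)` and `B ^ (1/3)` come from the `μ₆`-twist family at `j = 0` and the
    -- `μ₄`-twist family at `j = 1728`
    (EllCount.count (EllCount.ellipticCurves F B) : ℝ) =
      2 * EllCount.weightedCount (EllCount.ellipticCurves F B)
        + EllCount.delta F 6 * 4 * EllCount.weightedCount (EllCount.ellipticCurvesWithJ F 0 B)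
        + EllCount.delta F 4 * 2 *
          EllCount.weightedCount (EllCount.ellipticCurvesWithJ F 1728 B) ∧
    EllCount.weightedCount (EllCount.ellipticCurvesWithJ F 0 B) =
      (q ^ 5 - 1) / (q ^ 5 - q ^ 4) * B₀ ^ (1 / 2 : ℝ) + 1 ∧
    EllCount.weightedCount (EllCount.ellipticCurvesWithJ F 1728 B) =
      (q ^ 3 - 1) / (q ^ 3 - q ^ 2) * B₀ ^ (1 / 3 : ℝ) + 1 := by
  have h2 : (2 : F) ≠ 0 :=
    EllCount.natCast_ne_zero_of_lt_ringChar (n := 2) two_ne_zero (by omega)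
  have h3 : (3 : F) ≠ 0 := EllCount.natCast_ne_zero_of_lt_ringChar (n := 3) three_ne_zero hchar
  have hq1 : 1 < q := by rw [hq]; exact_mod_cast Finite.one_lt_card (α := F)
  have hq0 : 0 < q := by linarith
  have hq1' : q - 1 ≠ 0 := by linarith
  rw [hB₀] at hle
  -- The formulas for the families hold only for positive height bounds.
  obtain ⟨n, rfl⟩ : ∃ n, m = n + 1 := ⟨m - 1, by omega⟩
  have e56 : B₀ ^ (5 / 6 : ℝ) = q ^ (10 * (n + 1)) := by
    rw [hB₀, EllCount.rpow_eq_pow_of_mul_eq hq0.le (k := 10) (by norm_num)]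
  have e12 : B₀ ^ (1 / 2 : ℝ) = q ^ (6 * (n + 1)) := by
    rw [hB₀, EllCount.rpow_eq_pow_of_mul_eq hq0.le (k := 6) (by norm_num)]
  have e13 : B₀ ^ (1 / 3 : ℝ) = q ^ (4 * (n + 1)) := by
    rw [hB₀, EllCount.rpow_eq_pow_of_mul_eq hq0.le (k := 4) (by norm_num)]
  have e16 : B₀ ^ (1 / 6 : ℝ) = q ^ (2 * (n + 1)) := by
    rw [hB₀, EllCount.rpow_eq_pow_of_mul_eq hq0.le (k := 2) (by norm_num)]
  rw [EllCount.ellipticCurvesWithJ_zero_eq hq hle hlt h2 h3,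
    EllCount.ellipticCurvesWithJ_1728_eq hq hle hlt h2 h3,
    EllCount.ellipticCurves_eq hq hle hlt h2 h3, EllCount.stableCurves_eq hq hle hlt,
    EllCount.nodalCurves_eq hq hle hlt, e56, e12, e13, e16]
  -- The numerator q^(10(n+1)+2) - q^(10n+3) equals q^(10(n+1)) (q⁹ - 1)/q⁷; the other families
  -- simplify in the same way.
  have ws : EllCount.weightedCount (EllCount.boundedCurves (F := F) (n + 1) fun _ => True) =
      (q ^ 9 - 1) / (q ^ 8 - q ^ 7) * q ^ (10 * (n + 1)) + 1 := by
    rw [EllCount.weightedCount_stable h2 h3, ← hq, show q ^ 8 - q ^ 7 = q ^ 7 * (q - 1) by ring]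
    field_simp
    ring
  have wn : EllCount.weightedCount (EllCount.boundedCurves (F := F) (n + 1) fun W => W.Δ = 0) =
      q ^ (2 * (n + 1)) + 1 := by
    rw [EllCount.weightedCount_nodal h2 h3, ← hq]
    field_simp
    ring
  have w0 : EllCount.weightedCount
      (EllCount.boundedCurves (F := F) (n + 1) fun W => W.Δ ≠ 0 ∧ W.c₄ = 0) =
      (q ^ 5 - 1) / (q ^ 5 - q ^ 4) * q ^ (6 * (n + 1)) + 1 := by
    rw [EllCount.weightedCount_c₄_eq_zero h2 h3, ← hq,
      show q ^ 5 - q ^ 4 = q ^ 4 * (q - 1) by ring]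
    field_simp
    ring
  have w1728 : EllCount.weightedCount
      (EllCount.boundedCurves (F := F) (n + 1) fun W => W.Δ ≠ 0 ∧ W.c₆ = 0) =
      (q ^ 3 - 1) / (q ^ 3 - q ^ 2) * q ^ (4 * (n + 1)) + 1 := by
    rw [EllCount.weightedCount_c₆_eq_zero h2 h3, ← hq,
      show q ^ 3 - q ^ 2 = q ^ 2 * (q - 1) by ring]
    field_simp
    ring
  have cn := EllCount.count_nodal h2 h3 (n + 1)
  have cg := EllCount.count_generic h2 h3 (n + 1)
  have c0 := EllCount.count_c₄_eq_zero h2 h3 (n + 1)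
  have c1728 := EllCount.count_c₆_eq_zero h2 h3 (n + 1)
  obtain ⟨cs, wse⟩ := EllCount.count_stable_eq h2 h3 (n + 1)
  obtain ⟨ce, we⟩ := EllCount.count_elliptic_eq h2 h3 (n + 1)
  replace cs := congrArg (Nat.cast (R := ℝ)) cs
  replace ce := congrArg (Nat.cast (R := ℝ)) ce
  push_cast at cs ce
  rw [cg, c0, c1728] at ce
  refine ⟨fun W hW => ?_, EllCount.finite_isoClasses_boundedCurves h2 h3 _ EllCount.elliptic_smul,
    EllCount.finite_isoClasses_boundedCurves h2 h3 _ fun _ _ h => h, ?_, ?_, ?_, ws, wn, ?_, ?_,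
    ?_, w0, w1728⟩
  · have hΔ : W.Δ ≠ 0 := W.isUnit_Δ.ne_zero
    obtain ⟨C, Q, hQ, hC⟩ := EllCount.exists_smul_eq_minimal h2 h3 (Or.inl hΔ)
    exact ⟨(EllCount.faltingsHeight_nonneg_and_le_iff h2 h3 hQ hC).1,
      EllCount.minDiscDegree_eq h2 h3 hΔ⟩
  · linear_combination ws - wn - wse
  -- Subtracting twice the weighted decomposition leaves only the excess automorphisms at c₄ = 0 and
  -- c₆ = 0.
  · linear_combination ce - 2 * we + 2 * (ws - wn - wse) + 4 * EllCount.delta F 6 * w0 +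
      2 * EllCount.delta F 4 * w1728
  · linear_combination -wse
  · linear_combination -cs
  · linear_combination cn + 2 * wn
  · linear_combination ce - 2 * we
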